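/- Let $M$ be a connected smooth Riemannian manifold of dimension $m$ and let $\varphi:M\to\mathbb S^n$ be an isometric immersion into the unit sphere $\mathbb S^n\subset\mathbb R^{n+1}$ (for instance the inclusion of a submanifold). Let $\tau(\varphi)=\operatorname{trace}\nabla d\varphi$ be its tension field and $$\tau_2(\varphi)=-\Delta\tau(\varphi)-\operatorname{trace}R^{\mathbb S^n}(d\varphi,\tau(\varphi))d\varphi$$ its bitension field, where $\Delta=-\operatorname{trace}\nabla^2$ is the Laplacian on sections of $\varphi^{-1}T\mathbb S^n$ and $R(X,Y)Z=\nabla_X\nabla_YZ-\nabla_Y\nabla_XZ-\nabla_{[X,Y]}Z$. Assume that $M$ is a proper biharmonic submanifold, that is, $\tau_2(\varphi)=0$ everywhere (the Euler--Lagrange equation of the bienergy $\frac12\int_M|\tau(\varphi)|^2v_g$) and $\tau(\varphi)\not\equiv0$. Let $B$ be the second fundamental form of $M$ in $\mathbb S^n$, $H=\frac1m\operatorname{trace}B$ the mean curvature vector field, $\nabla$ the Levi-Civita connection of $M$, $\nabla^\perp$ the connection of the normal bundle of $M$ in $\mathbb S^n$, and $A_H$ the Weingarten operator in the direction $H$,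 given by $\langle A_HX,Y\rangle=\langle B(X,Y),H\rangle$. Put $$(\nabla A_H)(X,Y)=\nabla_X(A_HY)-A_H(\nabla_XY),$$ $$(\nabla^\perp B)(X,Y,Z)=\nabla^\perp_X(B(Y,Z))-B(\nabla_XY,Z)-B(Y,\nabla_XZ).$$ Assume that $H$ is parallel, i.e. $\nabla^\perp H=0$. Then: (i) $|A_H|^2=m|H|^2$ at every point of $M$, where $|A_H|^2=\sum_i|A_He_i|^2$ for an orthonormal basis $\{e_i\}$ of the tangent space, and this function is constant on $M$; (ii) $\operatorname{trace}\nabla A_H=\sum_i(\nabla A_H)(e_i,e_i)=0$ at every point of $M$; (iii) at every point of $M$ and for every tangent vector $X$ there, $$\Big\langle\sum_i(\nabla^\perp B)(X,e_i,A_He_i),H\Big\rangle=\Big\langle\sum_i(\nabla^\perp B)(e_i,X,A_He_i),H\Big\rangle=0.$$ -/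

import Mathlib

open scoped Manifold ContDiff Bundle

noncomputable section

namespace BiharmonicSphere

/-- The Euclidean space `ℝⁿ⁺¹`. -/
abbrev Euc (n : ℕ) : Type := EuclideanSpace ℝ (Fin (n + 1))

/-- The unit Euclidean sphere `Sⁿ` in `ℝⁿ⁺¹`. -/
abbrev Sph (n : ℕ) : Type := Metric.sphere (0 : Euc n) 1

section Sphere

variable {n : ℕ}

/-- For a unit vector `x`, the orthogonal projection of `ℝⁿ⁺¹` onto `T_x Sⁿ`, the orthogonal
complement of `x`. -/
def sphereProj (x u : Euc n) : Euc n := u - inner ℝ x u • x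

/-- The Levi-Civita connection of `Sⁿ`: at a point `x` of the sphere, `(∇_U W)(x)` is the
component tangent to the sphere of the derivative of `W` in the direction `U x`. Vector fields of
the sphere are represented by maps of `ℝⁿ⁺¹` to itself that are tangent to the sphere at its
points. -/
def sphereConn (U W : Euc n → Euc n) (x : Euc n) : Euc n :=
  sphereProj x (fderiv ℝ W x (U x))

/-- The curvature tensor of `Sⁿ`,
`R(u, v)w = ∇_U ∇_V W - ∇_V ∇_U W - ∇_{[U, V]} W`, for vectors `u, v, w` tangent to the sphere at
`x`; these are extended to the tangent vector fields `y ↦ sphereProj y u` etc. -/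
def sphereCurvature (x u v w : Euc n) : Euc n :=
  let U : Euc n → Euc n := fun y => sphereProj y u
  let V : Euc n → Euc n := fun y => sphereProj y v
  let W : Euc n → Euc n := fun y => sphereProj y w
  sphereConn U (sphereConn V W) x - sphereConn V (sphereConn U W) x
    - sphereConn (VectorField.lieBracket ℝ U V) W x

end Sphere

section Submanifold

variable (m : ℕ) {n : ℕ} {M : Type*} [TopologicalSpace M] [ChartedSpace (EuclideanSpace ℝ (Fin m)) M]
  [IsManifold (𝓡 m) ∞ M]

/-- The differential `dφ_p : T_pM → T_{φ(p)}Sⁿ ⊆ ℝⁿ⁺¹`. -/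
def dphi (φ : M → Sph n) (p : M) : TangentSpace (𝓡 m) p →L[ℝ] Euc n :=
  mvfderiv (𝓡 m) (fun q => (φ q : Euc n)) p

/-- The derivative at `p`, in the direction `v`, of a map with values in `ℝⁿ⁺¹`. -/
def dirDeriv (σ : M → Euc n) (p : M) (v : TangentSpace (𝓡 m) p) : Euc n :=
  mvfderiv (𝓡 m) σ p v

/-- A vector field on `M`, smooth near `p`, with the value `v` at `p`. -/
def extendVec {p : M} (v : TangentSpace (𝓡 m) p) : Π q : M, TangentSpace (𝓡 m) q :=
  FiberBundle.extend (EuclideanSpace ℝ (Fin m)) v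

/-- The connection `∇^φ` on `φ⁻¹TSⁿ` induced by the Levi-Civita connection of the sphere. A section
of `φ⁻¹TSⁿ` is a map `σ : M → ℝⁿ⁺¹` with `σ(p)` orthogonal to `φ(p)`. -/
def pullbackConn (φ : M → Sph n) (σ : M → Euc n) (p : M) (v : TangentSpace (𝓡 m) p) : Euc n :=
  sphereProj (φ p : Euc n) (dirDeriv m σ p v)

variable [Bundle.RiemannianBundle (fun p : M => TangentSpace (𝓡 m) p)]

instance instFiniteDimensionalTangentSpace (p : M) : FiniteDimensional ℝ (TangentSpace (𝓡 m) p) :=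
  inferInstanceAs (FiniteDimensional ℝ (EuclideanSpace ℝ (Fin m)))

/-- `φ : M → Sⁿ` is an isometric immersion of the Riemannian manifold `M`. -/
structure IsIsometricImmersion (φ : M → Sph n) : Prop where
  contMDiff : ContMDiff (𝓡 m) (𝓡 n) ∞ φ
  inner_dphi : ∀ (p : M) (v w : TangentSpace (𝓡 m) p),
    inner ℝ (dphi m φ p v) (dphi m φ p w) = inner ℝ v w

/-- An orthonormal basis of `T_pM`. -/
def frame (p : M) : OrthonormalBasis (Fin (Module.finrank ℝ (TangentSpace (𝓡 m) p))) ℝ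
    (TangentSpace (𝓡 m) p) :=
  stdOrthonormalBasis ℝ (TangentSpace (𝓡 m) p)

/-- The trace of a bilinear form on `T_pM`, with values in any vector space. -/
def trace {V : Type*} [AddCommGroup V] (p : M)
    (b : TangentSpace (𝓡 m) p → TangentSpace (𝓡 m) p → V) : V :=
  ∑ i, b (frame m p i) (frame m p i)

/-- The tangent vector of `M` whose image is the orthogonal projection of `u` onto `dφ(T_pM)`
(`dφ_p` being a linear isometry). -/
def tangentPart (φ : M → Sph n) (p : M) (u : Euc n) : TangentSpace (𝓡 m) p :=
  LinearMap.adjoint (dphi m φ p : TangentSpace (𝓡 m) p →ₗ[ℝ] Euc n) u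

/-- The orthogonal projection of `u` onto the normal space of `M` in `Sⁿ`, that is, onto the
orthogonal complement of `dφ(T_pM)` in `T_{φ(p)}Sⁿ`. -/
def normalPart (φ : M → Sph n) (p : M) (u : Euc n) : Euc n :=
  sphereProj (φ p : Euc n) u - dphi m φ p (tangentPart m φ p u)

/-- The Levi-Civita connection of `M`: `∇_v X` is the tangential component of `∇^φ_v (dφ X)`. -/
def leviCivita (φ : M → Sph n) (X : Π q : M, TangentSpace (𝓡 m) q) (p : M)
    (v : TangentSpace (𝓡 m) p) : TangentSpace (𝓡 m) p :=
  tangentPart m φ p (pullbackConn m φ (fun q => dphi m φ q (X q)) p v)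

/-! ### Harmonic and biharmonic maps -/

/-- `(∇dφ)(v, w) = ∇^φ_v (dφ W) - dφ(∇_v W)`. -/
def nablaDphi (φ : M → Sph n) (p : M) (v w : TangentSpace (𝓡 m) p) : Euc n :=
  pullbackConn m φ (fun q => dphi m φ q (extendVec m w q)) p v
    - dphi m φ p (leviCivita m φ (extendVec m w) p v)

/-- The tension field `τ(φ) = trace ∇dφ`. -/
def tension (φ : M → Sph n) (p : M) : Euc n := trace m p (nablaDphi m φ p)

/-- The Laplacian on sections of `φ⁻¹TSⁿ`,
`Δσ = - trace ∇²σ`, with `∇²σ(v, w) = ∇^φ_v ∇^φ_W σ - ∇^φ_{∇_v W} σ`. -/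
def laplacian (φ : M → Sph n) (σ : M → Euc n) (p : M) : Euc n :=
  -trace m p fun v w =>
    pullbackConn m φ (fun q => pullbackConn m φ σ q (extendVec m w q)) p v
      - pullbackConn m φ σ p (leviCivita m φ (extendVec m w) p v)

/-- The bitension field `τ₂(φ) = - Δτ(φ) - trace R(dφ, τ(φ))dφ`. -/
def bitension (φ : M → Sph n) (p : M) : Euc n :=
  -laplacian m φ (tension m φ) p
    - trace m p fun v w => sphereCurvature (φ p : Euc n) (dphi m φ p v) (tension m φ p) (dphi m φ p w)

/-- `φ` is harmonic. -/
def IsHarmonic (φ : M → Sph n) : Prop := ∀ p, tension m φ p = 0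

/-- `φ` is biharmonic: it solves the Euler-Lagrange equation `τ₂(φ) = 0` of the bienergy
`½ ∫ |τ(φ)|²`. -/
def IsBiharmonic (φ : M → Sph n) : Prop := ∀ p, bitension m φ p = 0

/-- `φ` is proper biharmonic: biharmonic and not harmonic. -/
def IsProperBiharmonic (φ : M → Sph n) : Prop := IsBiharmonic m φ ∧ ¬ IsHarmonic m φ

/-! ### The second fundamental form -/

/-- The second fundamental form `B` of `M` in `Sⁿ`. -/
def secondFF (φ : M → Sph n) (p : M) (v w : TangentSpace (𝓡 m) p) : Euc n :=
  normalPart m φ p (pullbackConn m φ (fun q => dphi m φ q (extendVec m w q)) p v)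

/-- The mean curvature vector field `H = (1/m) trace B`. -/
def meanCurv (φ : M → Sph n) (p : M) : Euc n := (m : ℝ)⁻¹ • trace m p (secondFF m φ p)

/-- The connection `∇^⊥` of the normal bundle of `M` in `Sⁿ`. -/
def normalConn (φ : M → Sph n) (ξ : M → Euc n) (p : M) (v : TangentSpace (𝓡 m) p) : Euc n :=
  normalPart m φ p (pullbackConn m φ ξ p v)

/-- The submanifold has parallel mean curvature vector field: `∇^⊥H = 0`. -/
def HasParallelMeanCurv (φ : M → Sph n) : Prop :=
  ∀ (p : M) (v : TangentSpace (𝓡 m) p), normalConn m φ (meanCurv m φ) p v = 0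

/-- The Weingarten operator `A_ξ` of `M`, for a normal vector `ξ`: the operator on `T_pM` with
`⟨A_ξ v, w⟩ = ⟨B(v, w), ξ⟩`. -/
def weingarten (φ : M → Sph n) (p : M) (ξ : Euc n) (v : TangentSpace (𝓡 m) p) :
    TangentSpace (𝓡 m) p :=
  ∑ i, (inner ℝ (secondFF m φ p v (frame m p i)) ξ : ℝ) • frame m p i

/-- The operator `A_H` at `p`. -/
def AH (φ : M → Sph n) (p : M) (v : TangentSpace (𝓡 m) p) : TangentSpace (𝓡 m) p :=
  weingarten m φ p (meanCurv m φ p) v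

/-- `|A_H|²` at `p`. -/
def normSqAH (φ : M → Sph n) (p : M) : ℝ :=
  trace m p fun v w => inner ℝ (AH m φ p v) (AH m φ p w)

/-- `(∇A_H)(v, w) = (∇_v A_H)(w) = ∇_v (A_H W) - A_H(∇_v W)`. -/
def nablaAH (φ : M → Sph n) (p : M) (v w : TangentSpace (𝓡 m) p) : TangentSpace (𝓡 m) p :=
  leviCivita m φ (fun q => AH m φ q (extendVec m w q)) p v
    - AH m φ p (leviCivita m φ (extendVec m w) p v)

/-- `(∇^⊥B)(u, v, w) = (∇^⊥_u B)(v, w) = ∇^⊥_u (B(V, W)) - B(∇_u V, w) - B(v, ∇_u W)`. -/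
def nablaB (φ : M → Sph n) (p : M) (u v w : TangentSpace (𝓡 m) p) : Euc n :=
  normalConn m φ (fun q => secondFF m φ q (extendVec m v q) (extendVec m w q)) p u
    - secondFF m φ p (leviCivita m φ (extendVec m v) p u) w
    - secondFF m φ p v (leviCivita m φ (extendVec m w) p u)

end Submanifold

end BiharmonicSphere

end

/-! Everything is computed in `ℝⁿ⁺¹`, with operator fields on the fixed space `Euc n` replacing
tensors on `M`. Write `P` for `tanProj`, the field of orthogonal projections onto `dφ(T_pM)`, and
`D_u σ` for `tder`, the derivative of `σ` along the tangential part of `u`. The second fundamental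
form is `B(v, w) = (D_v P) w + ⟨v, w⟩ φ` (`secondFF_eq`).

Put `S = -DH` (`shapeOp`). If `H` is parallel, `S` is symmetric with tangential values: it is `A_H`
extended by zero. Differentiating `S H = 0` gives `(D_u S) H = S² u`, and the symmetry of second
derivatives of `H` gives the Codazzi equation `(D_u S) w = (D_w S) u` for tangential `u`, `w`.

Since `τ = mH` and `Sⁿ` has curvature one, the biharmonic equation says that the component of `∑
(D_{e_i} S) e_i` orthogonal to `φ` is `mH` (`trace_tder_shapeOp_of_isBiharmonic`). Its tangential
part is (ii). Its product with `H` is `|A_H|² = m|H|²`, because `∑ ⟨(D_{e_i} S) e_i, H⟩ = ∑ ⟨e_i, S²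
e_i⟩`. The function `|H|²` is constant because `DH` is tangential and `H` is normal.

For (iii), `⟨(∇^⊥B)(u, v, w), H⟩ = ⟨(D_u S) v, w⟩`. The first trace is therefore half the derivative
of the constant `|A_H|²`, and the Codazzi equation turns the second trace into the first. -/

noncomputable section

namespace BiharmonicSphere

set_option linter.unusedSectionVars false

/-! ### Smooth left inverses of injective linear maps. -/

section PseudoInverse

variable {E V : Type*} [NormedAddCommGroup E] [InnerProductSpace ℝ E] [FiniteDimensional ℝ E]
  [NormedAddCommGroup V] [InnerProductSpace ℝ V] [FiniteDimensional ℝ V]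

/-- The left inverse `(JᵀJ)⁻¹Jᵀ` of an injective linear map `J`. -/
def pinv (J : E →L[ℝ] V) : V →L[ℝ] E :=
  haveI := FiniteDimensional.complete ℝ E
  haveI := FiniteDimensional.complete ℝ V
  (J.adjoint ∘L J).inverse ∘L J.adjoint

variable [CompleteSpace E] [CompleteSpace V]

theorem isInvertible_adjoint_comp_self {J : E →L[ℝ] V} (hJ : Function.Injective J) :
    (J.adjoint ∘L J).IsInvertible := by
  have hinj : Function.Injective (J.adjoint ∘L J) := by
    rw [injective_iff_map_eq_zero]
    intro v hv
    have h : inner ℝ (J v) (J v) = 0 := by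
      rw [← ContinuousLinearMap.adjoint_inner_left]
      simpa using congrArg (fun z => inner ℝ z v) hv
    exact (injective_iff_map_eq_zero J).1 hJ v (inner_self_eq_zero.1 h)
  refine ⟨(LinearEquiv.ofInjectiveEndo ((J.adjoint ∘L J : E →L[ℝ] E) : E →ₗ[ℝ] E)
    hinj).toContinuousLinearEquiv, ?_⟩
  ext v
  rfl

/-- The hypothesis says that `u - J v` is orthogonal to the range of `J`, so `pinv J` gives the
coordinates of the orthogonal projection of `u` onto that range. -/
theorem pinv_apply_of_adjoint_eq {J : E →L[ℝ] V} (hJ : Function.Injective J) {u : V} {v : E}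
    (h : J.adjoint u = J.adjoint (J v)) : pinv J u = v := by
  change (J.adjoint ∘L J).inverse (J.adjoint u) = v
  rw [h]
  exact (isInvertible_adjoint_comp_self hJ).inverse_apply_eq.2 rfl

/-- Taking adjoints is linear over `ℝ`, and operator inversion is smooth at an invertible operator.
-/
theorem contDiffAt_pinv {J : E →L[ℝ] V} (hJ : Function.Injective J) :
    ContDiffAt ℝ ∞ (pinv : (E →L[ℝ] V) → (V →L[ℝ] E)) J := by
  have hadj : ContDiff ℝ ∞ (fun J : E →L[ℝ] V => J.adjoint) :=
    (ContinuousLinearMap.adjoint (𝕜 := ℝ) (E := E)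
      (F := V)).toContinuousLinearEquiv.toContinuousLinearMap.contDiff
  have hcomp : ContDiff ℝ ∞ (fun J : E →L[ℝ] V => J.adjoint ∘L J) := hadj.clm_comp contDiff_id
  exact (ContDiffAt.comp (f := fun J : E →L[ℝ] V => J.adjoint ∘L J)
    (g := ContinuousLinearMap.inverse) J (isInvertible_adjoint_comp_self hJ).contDiffAt_map_inverse
    hcomp.contDiffAt).clm_comp hadj.contDiffAt

end PseudoInverse

/-! ### Derivatives of vector-valued maps on `M`, read in charts. -/

section Chart

variable {m : ℕ} {M : Type*} [TopologicalSpace M] [ChartedSpace (EuclideanSpace ℝ (Fin m)) M]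
  [IsManifold (𝓡 m) ∞ M]
  {W W₁ W₂ W₃ : Type*} [NormedAddCommGroup W] [NormedSpace ℝ W] [NormedAddCommGroup W₁]
  [NormedSpace ℝ W₁] [NormedAddCommGroup W₂] [NormedSpace ℝ W₂] [NormedAddCommGroup W₃]
  [NormedSpace ℝ W₃]

/-- The differential at `q` of the preferred chart at `p`. -/
def chartDeriv (m : ℕ) {M : Type*} [TopologicalSpace M] [ChartedSpace (EuclideanSpace ℝ (Fin m)) M]
    (p q : M) : TangentSpace (𝓡 m) q →L[ℝ] EuclideanSpace ℝ (Fin m) :=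
  mvfderiv (𝓡 m) (extChartAt (𝓡 m) p) q

theorem chartDeriv_bijective {p q : M} (hq : q ∈ (extChartAt (𝓡 m) p).source) :
    Function.Bijective (chartDeriv m p q) := by
  have : IsManifold (𝓡 m) 1 M := IsManifold.of_le (n := ∞) (by simp)
  obtain ⟨e, he⟩ := isInvertible_mfderiv_extChartAt (I := 𝓡 m) hq
  have : ⇑(chartDeriv m p q) = e := by
    ext1 v
    exact congrArg (fun L => L v) he.symm
  rw [this]
  exact e.bijective

theorem chartDeriv_eq_continuousLinearMapAt {p q : M} (hq : q ∈ (extChartAt (𝓡 m) p).source) :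
    chartDeriv m p q = (trivializationAt (EuclideanSpace ℝ (Fin m)) (TangentSpace (𝓡 m))
      p).continuousLinearMapAt ℝ q := by
  have : IsManifold (𝓡 m) 1 M := IsManifold.of_le (n := ∞) (by simp)
  rw [TangentBundle.continuousLinearMapAt_trivializationAt (by simpa using hq)]
  rfl

/-- The extension is constant in the trivialization at `p`, whose fibre maps are the differentials
of the chart; hence its coordinates are constant. -/
theorem chartDeriv_extendVec {p q : M} (hq : q ∈ (extChartAt (𝓡 m) p).source)
    (v : TangentSpace (𝓡 m) p) :
    chartDeriv m p q (extendVec m v q) = chartDeriv m p p v := by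
  have hb : ∀ r ∈ (extChartAt (𝓡 m) p).source, r ∈ (trivializationAt (EuclideanSpace ℝ (Fin m))
      (TangentSpace (𝓡 m)) p).baseSet := fun r hr => by simpa using hr
  have hp := mem_extChartAt_source (I := 𝓡 m) p
  rw [chartDeriv_eq_continuousLinearMapAt hq, chartDeriv_eq_continuousLinearMapAt hp, extendVec,
    FiberBundle.extend, ← Bundle.Trivialization.symmL_apply (R := ℝ) _ (hb q hq),
    Bundle.Trivialization.continuousLinearMapAt_symmL _ (hb q hq),
    Bundle.Trivialization.continuousLinearMapAt_apply,
    Bundle.Trivialization.coe_linearMapAt_of_mem _ (hb p hp)]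

theorem MDifferentiableAt.comp_extChartAt_symm {σ : M → W} {p q : M}
    (hq : q ∈ (extChartAt (𝓡 m) p).source) (hσ : MDifferentiableAt (𝓡 m) 𝓘(ℝ, W) σ q) :
    DifferentiableAt ℝ (σ ∘ (extChartAt (𝓡 m) p).symm) (extChartAt (𝓡 m) p q) := by
  have : IsManifold (𝓡 m) 1 M := IsManifold.of_le (n := ∞) (by simp)
  have h := mdifferentiableWithinAt_extChartAt_symm (I := 𝓡 m) (x := p)
    ((extChartAt (𝓡 m) p).map_source hq)
  rw [ModelWithCorners.range_eq_univ, mdifferentiableWithinAt_univ] at h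
  exact (MDifferentiableAt.comp_of_eq _ hσ h
    ((extChartAt (𝓡 m) p).left_inv hq)).differentiableAt

theorem eventuallyEq_comp_extChartAt_symm (σ : M → W) {p q : M}
    (hq : q ∈ (extChartAt (𝓡 m) p).source) :
    σ =ᶠ[nhds q] (σ ∘ (extChartAt (𝓡 m) p).symm) ∘ extChartAt (𝓡 m) p := by
  filter_upwards [(isOpen_extChartAt_source (I := 𝓡 m) p).mem_nhds hq] with r hr
  simp only [Function.comp_apply, (extChartAt (𝓡 m) p).left_inv hr]

theorem mvfderiv_congr {σ ρ : M → W} {p : M} (h : σ =ᶠ[nhds p] ρ) :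
    mvfderiv (𝓡 m) σ p = mvfderiv (𝓡 m) ρ p := by
  ext v
  exact congrArg (fun L : EuclideanSpace ℝ (Fin m) →L[ℝ] W => L v) h.mfderiv_eq

theorem mvfderiv_fderiv_comp {V : Type*} [NormedAddCommGroup V] [NormedSpace ℝ V]
    {g : V → W} {σ : M → V} {p : M} (hg : DifferentiableAt ℝ g (σ p))
    (hσ : MDifferentiableAt (𝓡 m) 𝓘(ℝ, V) σ p) :
    mvfderiv (𝓡 m) (g ∘ σ) p = fderiv ℝ g (σ p) ∘L mvfderiv (𝓡 m) σ p := by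
  have h := mfderiv_comp p hg.mdifferentiableAt hσ
  rw [mfderiv_eq_fderiv] at h
  exact h

theorem mvfderiv_eq_fderiv_comp_chartDeriv {σ : M → W} {p q : M}
    (hq : q ∈ (extChartAt (𝓡 m) p).source) (hσ : MDifferentiableAt (𝓡 m) 𝓘(ℝ, W) σ q) :
    mvfderiv (𝓡 m) σ q = (fderiv ℝ (σ ∘ (extChartAt (𝓡 m) p).symm) (extChartAt (𝓡 m) p q)) ∘L
      chartDeriv m p q := by
  have : IsManifold (𝓡 m) 1 M := IsManifold.of_le (n := ∞) (by simp)
  rw [mvfderiv_congr (eventuallyEq_comp_extChartAt_symm σ hq), mvfderiv_fderiv_comp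
    (MDifferentiableAt.comp_extChartAt_symm hq hσ)
    (mdifferentiableAt_extChartAt (by simpa using hq))]
  rfl

theorem mvfderiv_clm_comp (L : W →L[ℝ] W₁) {σ : M → W} {p : M}
    (hσ : MDifferentiableAt (𝓡 m) 𝓘(ℝ, W) σ p) (v : TangentSpace (𝓡 m) p) :
    mvfderiv (𝓡 m) (fun q => L (σ q)) p v = L (mvfderiv (𝓡 m) σ p v) := by
  have h := mvfderiv_fderiv_comp (g := L) L.differentiableAt hσ
  rw [L.fderiv] at h
  exact congrArg (fun A => A v) h

theorem MDifferentiableAt.bilinear (B : W₁ →L[ℝ] W₂ →L[ℝ] W₃) {σ : M → W₁} {ρ : M → W₂} {p : M}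
    (hσ : MDifferentiableAt (𝓡 m) 𝓘(ℝ, W₁) σ p) (hρ : MDifferentiableAt (𝓡 m) 𝓘(ℝ, W₂) ρ p) :
    MDifferentiableAt (𝓡 m) 𝓘(ℝ, W₃) (fun q => B (σ q) (ρ q)) p :=
  (B.differentiableAt.comp_mdifferentiableAt hσ).clm_apply hρ

theorem mvfderiv_bilinear (B : W₁ →L[ℝ] W₂ →L[ℝ] W₃) {σ : M → W₁} {ρ : M → W₂} {p : M}
    (hσ : MDifferentiableAt (𝓡 m) 𝓘(ℝ, W₁) σ p) (hρ : MDifferentiableAt (𝓡 m) 𝓘(ℝ, W₂) ρ p)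
    (v : TangentSpace (𝓡 m) p) :
    mvfderiv (𝓡 m) (fun q => B (σ q) (ρ q)) p v =
      B (σ p) (mvfderiv (𝓡 m) ρ p v) + B (mvfderiv (𝓡 m) σ p v) (ρ p) := by
  have hp := mem_extChartAt_source (I := 𝓡 m) p
  have h₁ := MDifferentiableAt.comp_extChartAt_symm hp hσ
  have h₂ := MDifferentiableAt.comp_extChartAt_symm hp hρ
  have h := B.hasFDerivAt_of_bilinear h₁.hasFDerivAt h₂.hasFDerivAt
  rw [mvfderiv_eq_fderiv_comp_chartDeriv hp hσ, mvfderiv_eq_fderiv_comp_chartDeriv hp hρ,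
    mvfderiv_eq_fderiv_comp_chartDeriv hp (MDifferentiableAt.bilinear B hσ hρ)]
  change fderiv ℝ (fun x => B ((σ ∘ (extChartAt (𝓡 m) p).symm) x)
    ((ρ ∘ (extChartAt (𝓡 m) p).symm) x)) _ _ = _
  rw [h.fderiv]
  simp only [Function.comp_apply, extChartAt_to_inv]
  rfl

theorem ContMDiffAt.comp_extChartAt_symm {σ : M → W} {p q : M}
    (hq : q ∈ (extChartAt (𝓡 m) p).source) (hσ : ContMDiffAt (𝓡 m) 𝓘(ℝ, W) ∞ σ q) :
    ContDiffAt ℝ ∞ (σ ∘ (extChartAt (𝓡 m) p).symm) (extChartAt (𝓡 m) p q) := by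
  have hq' := (extChartAt (𝓡 m) p).map_source hq
  have h := contMDiffOn_extChartAt_symm (I := 𝓡 m) (n := ∞) p _ hq'
  have h' := h.contMDiffAt ((isOpen_extChartAt_target (I := 𝓡 m) p).mem_nhds hq')
  exact (ContMDiffAt.comp_of_eq hσ h' ((extChartAt (𝓡 m) p).left_inv hq)).contDiffAt

/-- A map of `M` with vanishing differential is constant if `M` is connected. -/
theorem eq_of_mvfderiv_eq_zero [ConnectedSpace M] {σ : M → W}
    (hσ : MDifferentiable (𝓡 m) 𝓘(ℝ, W) σ) (h : ∀ p, mvfderiv (𝓡 m) σ p = 0) (p q : M) :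
    σ p = σ q := by
  refine IsLocallyConstant.apply_eq_of_isPreconnected ((IsLocallyConstant.iff_eventually_eq σ).2
    fun r => ?_) isPreconnected_univ (Set.mem_univ p) (Set.mem_univ q)
  have hr := mem_extChartAt_source (I := 𝓡 m) r
  obtain ⟨ε, hε, hb⟩ := Metric.isOpen_iff.1 (isOpen_extChartAt_target (I := 𝓡 m) r) _
    ((extChartAt (𝓡 m) r).map_source hr)
  have hd : ∀ x ∈ Metric.ball (extChartAt (𝓡 m) r r) ε,
      HasFDerivAt (σ ∘ (extChartAt (𝓡 m) r).symm) (0 : _ →L[ℝ] W) x := by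
    intro x hx
    have hs := (extChartAt (𝓡 m) r).map_target (hb hx)
    have h₁ := MDifferentiableAt.comp_extChartAt_symm hs (hσ _)
    have h₂ := mvfderiv_eq_fderiv_comp_chartDeriv hs (hσ _)
    rw [(extChartAt (𝓡 m) r).right_inv (hb hx)] at h₁ h₂
    have h₃ : fderiv ℝ (σ ∘ (extChartAt (𝓡 m) r).symm) x = 0 := by
      ext v
      obtain ⟨w, rfl⟩ := (chartDeriv_bijective hs).2 v
      rw [h] at h₂
      exact (congrArg (fun A => A w) h₂).symm
    rw [← h₃]
    exact h₁.hasFDerivAt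
  have hc : extChartAt (𝓡 m) r ⁻¹' Metric.ball (extChartAt (𝓡 m) r r) ε ∈ nhds r :=
    (continuousAt_extChartAt (I := 𝓡 m) r).preimage_mem_nhds (Metric.ball_mem_nhds _ hε)
  filter_upwards [hc, (isOpen_extChartAt_source (I := 𝓡 m) r).mem_nhds hr] with s hs hs'
  have := (convex_ball (extChartAt (𝓡 m) r r) ε).is_const_of_fderivWithin_eq_zero (𝕜 := ℝ)
    (fun x hx => (hd x hx).differentiableAt.differentiableWithinAt)
    (fun x hx => (hd x hx).hasFDerivWithinAt.fderivWithin
      (Metric.isOpen_ball.uniqueDiffWithinAt hx)) hs (Metric.mem_ball_self hε)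
  simpa only [Function.comp_apply, (extChartAt (𝓡 m) r).left_inv hs',
    (extChartAt (𝓡 m) r).left_inv hr] using this

end Chart

/-! ### The tangential derivative, its smoothness and its commutator. -/

section TangentialDerivative

variable {m n : ℕ} {M : Type*} [TopologicalSpace M]
  [ChartedSpace (EuclideanSpace ℝ (Fin m)) M] [IsManifold (𝓡 m) ∞ M]
  [Bundle.RiemannianBundle (fun p : M => TangentSpace (𝓡 m) p)]
  {W : Type*} [NormedAddCommGroup W] [NormedSpace ℝ W]
  {φ : M → Sph n}

theorem inner_tangentPart (φ : M → Sph n) (p : M) (u : Euc n) (v : TangentSpace (𝓡 m) p) :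
    inner ℝ (tangentPart m φ p u) v = inner ℝ u (dphi m φ p v) :=
  LinearMap.adjoint_inner_left (dphi m φ p : TangentSpace (𝓡 m) p →ₗ[ℝ] Euc n) v u

theorem IsIsometricImmersion.tangentPart_dphi (hφ : IsIsometricImmersion m φ) (p : M)
    (v : TangentSpace (𝓡 m) p) : tangentPart m φ p (dphi m φ p v) = v := by
  refine ext_inner_right ℝ fun w => ?_
  rw [inner_tangentPart, hφ.inner_dphi]

/-- `tangentPart` as a continuous linear map. -/
def tangentPartL (m : ℕ) {M : Type*} [TopologicalSpace M]
    [ChartedSpace (EuclideanSpace ℝ (Fin m)) M] [IsManifold (𝓡 m) ∞ M]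
    [Bundle.RiemannianBundle (fun p : M => TangentSpace (𝓡 m) p)] (φ : M → Sph n) (p : M) :
    Euc n →L[ℝ] TangentSpace (𝓡 m) p :=
  LinearMap.toContinuousLinearMap
    (LinearMap.adjoint (dphi m φ p : TangentSpace (𝓡 m) p →ₗ[ℝ] Euc n))

/-- The derivative of `σ` at `p` along the tangential component of a vector of `ℝⁿ⁺¹`. -/
def tder (m : ℕ) {M : Type*} [TopologicalSpace M]
    [ChartedSpace (EuclideanSpace ℝ (Fin m)) M] [IsManifold (𝓡 m) ∞ M]
    [Bundle.RiemannianBundle (fun p : M => TangentSpace (𝓡 m) p)] (φ : M → Sph n)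
    (σ : M → W) (p : M) : Euc n →L[ℝ] W :=
  mvfderiv (𝓡 m) σ p ∘L tangentPartL m φ p

/-- The orthogonal projection of `ℝⁿ⁺¹` onto `dφ(T_pM)`. -/
def tanProj (m : ℕ) {M : Type*} [TopologicalSpace M]
    [ChartedSpace (EuclideanSpace ℝ (Fin m)) M] [IsManifold (𝓡 m) ∞ M]
    [Bundle.RiemannianBundle (fun p : M => TangentSpace (𝓡 m) p)] (φ : M → Sph n) (p : M) :
    Euc n →L[ℝ] Euc n :=
  tder m φ (fun q => (φ q : Euc n)) p

theorem tder_apply (σ : M → W) (p : M) (u : Euc n) :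
    tder m φ σ p u = mvfderiv (𝓡 m) σ p (tangentPart m φ p u) := rfl

theorem tanProj_apply (p : M) (u : Euc n) :
    tanProj m φ p u = dphi m φ p (tangentPart m φ p u) := rfl

theorem IsIsometricImmersion.tder_dphi (hφ : IsIsometricImmersion m φ) (σ : M → W) (p : M)
    (v : TangentSpace (𝓡 m) p) : tder m φ σ p (dphi m φ p v) = mvfderiv (𝓡 m) σ p v := by
  rw [tder_apply, hφ.tangentPart_dphi]

theorem IsIsometricImmersion.tder_tanProj (hφ : IsIsometricImmersion m φ) (σ : M → W) (p : M)
    (u : Euc n) : tder m φ σ p (tanProj m φ p u) = tder m φ σ p u := by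
  rw [tanProj_apply, hφ.tder_dphi, tder_apply]

theorem IsIsometricImmersion.tanProj_dphi (hφ : IsIsometricImmersion m φ) (p : M)
    (v : TangentSpace (𝓡 m) p) : tanProj m φ p (dphi m φ p v) = dphi m φ p v :=
  hφ.tder_dphi _ p v

theorem IsIsometricImmersion.tanProj_tanProj (hφ : IsIsometricImmersion m φ) (p : M)
    (u : Euc n) : tanProj m φ p (tanProj m φ p u) = tanProj m φ p u :=
  hφ.tder_tanProj _ p u

theorem inner_tanProj (p : M) (u w : Euc n) :
    inner ℝ (tanProj m φ p u) w = inner ℝ u (tanProj m φ p w) := by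
  rw [tanProj_apply, tanProj_apply, ← inner_tangentPart, real_inner_comm, ← inner_tangentPart,
    real_inner_comm]

theorem IsIsometricImmersion.contMDiff_coe (hφ : IsIsometricImmersion m φ) :
    ContMDiff (𝓡 m) 𝓘(ℝ, Euc n) ∞ (fun q => (φ q : Euc n)) := by
  have := Fact.mk (@finrank_euclideanSpace_fin ℝ _ (n + 1))
  exact (contMDiff_coe_sphere (E := Euc n) (n := n)).comp hφ.contMDiff

theorem IsIsometricImmersion.dphi_injective (hφ : IsIsometricImmersion m φ) (p : M) :
    Function.Injective (dphi m φ p) :=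
  Function.LeftInverse.injective (hφ.tangentPart_dphi p)

/-- The immersion in the preferred chart at `p`. -/
def localRep (m : ℕ) {M : Type*} [TopologicalSpace M]
    [ChartedSpace (EuclideanSpace ℝ (Fin m)) M] (φ : M → Sph n) (p : M) :
    EuclideanSpace ℝ (Fin m) → Euc n :=
  (fun q => (φ q : Euc n)) ∘ (extChartAt (𝓡 m) p).symm

theorem IsIsometricImmersion.dphi_eq_fderiv_localRep (hφ : IsIsometricImmersion m φ) {p q : M}
    (hq : q ∈ (extChartAt (𝓡 m) p).source) :
    dphi m φ q = fderiv ℝ (localRep m φ p) (extChartAt (𝓡 m) p q) ∘L chartDeriv m p q :=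
  mvfderiv_eq_fderiv_comp_chartDeriv hq (hφ.contMDiff_coe.mdifferentiable (by simp) q)

theorem IsIsometricImmersion.fderiv_localRep_injective (hφ : IsIsometricImmersion m φ) {p q : M}
    (hq : q ∈ (extChartAt (𝓡 m) p).source) :
    Function.Injective (fderiv ℝ (localRep m φ p) (extChartAt (𝓡 m) p q)) := by
  have h : ⇑(dphi m φ q) = fderiv ℝ (localRep m φ p) (extChartAt (𝓡 m) p q) ∘ chartDeriv m p q :=
    congrArg DFunLike.coe (hφ.dphi_eq_fderiv_localRep hq)
  have hi := hφ.dphi_injective q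
  rw [h] at hi
  exact (Function.Injective.of_comp_iff' _ (chartDeriv_bijective hq)).1 hi

/-- `tangentPart` uses the metric of `M` and `pinv` the Euclidean metric of the chart, but both
project `u` orthogonally onto the same image. The smoothness of `tder` thus comes from that of `φ`
alone, with no regularity asked of the metric as a bundle datum. -/
theorem IsIsometricImmersion.chartDeriv_tangentPart (hφ : IsIsometricImmersion m φ) {p q : M}
    (hq : q ∈ (extChartAt (𝓡 m) p).source) (u : Euc n) :
    chartDeriv m p q (tangentPart m φ q u) =
      pinv (fderiv ℝ (localRep m φ p) (extChartAt (𝓡 m) p q)) u := by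
  have hJ : ∀ v, fderiv ℝ (localRep m φ p) (extChartAt (𝓡 m) p q) (chartDeriv m p q v) =
      dphi m φ q v := fun v => congrArg (fun A => A v) (hφ.dphi_eq_fderiv_localRep hq).symm
  refine (pinv_apply_of_adjoint_eq (hφ.fderiv_localRep_injective hq) ?_).symm
  refine ext_inner_right ℝ fun z => ?_
  obtain ⟨v, rfl⟩ := (chartDeriv_bijective hq).2 z
  rw [ContinuousLinearMap.adjoint_inner_left, ContinuousLinearMap.adjoint_inner_left, hJ, hJ,
    ← tanProj_apply, inner_tanProj, hφ.tanProj_dphi]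

theorem IsIsometricImmersion.tder_eq (hφ : IsIsometricImmersion m φ) {σ : M → W} {p q : M}
    (hq : q ∈ (extChartAt (𝓡 m) p).source) (hσ : MDifferentiableAt (𝓡 m) 𝓘(ℝ, W) σ q) :
    tder m φ σ q = fderiv ℝ (σ ∘ (extChartAt (𝓡 m) p).symm) (extChartAt (𝓡 m) p q) ∘L
      pinv (fderiv ℝ (localRep m φ p) (extChartAt (𝓡 m) p q)) := by
  ext1 u
  rw [tder_apply, mvfderiv_eq_fderiv_comp_chartDeriv hq hσ]
  exact congrArg _ (hφ.chartDeriv_tangentPart hq u)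

theorem IsIsometricImmersion.contDiffAt_localRep (hφ : IsIsometricImmersion m φ) {p q : M}
    (hq : q ∈ (extChartAt (𝓡 m) p).source) :
    ContDiffAt ℝ ∞ (localRep m φ p) (extChartAt (𝓡 m) p q) :=
  ContMDiffAt.comp_extChartAt_symm hq (hφ.contMDiff_coe q)

theorem IsIsometricImmersion.contDiffAt_pinv_localRep (hφ : IsIsometricImmersion m φ) {p q : M}
    (hq : q ∈ (extChartAt (𝓡 m) p).source) :
    ContDiffAt ℝ ∞ (fun x => pinv (fderiv ℝ (localRep m φ p) x)) (extChartAt (𝓡 m) p q) :=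
  ContDiffAt.comp (g := pinv) (f := fun x => fderiv ℝ (localRep m φ p) x) _
    (contDiffAt_pinv (hφ.fderiv_localRep_injective hq))
    ((hφ.contDiffAt_localRep hq).fderiv_right (m := ∞) (by simp))

theorem IsIsometricImmersion.contMDiff_tder (hφ : IsIsometricImmersion m φ) {σ : M → W}
    (hσ : ContMDiff (𝓡 m) 𝓘(ℝ, W) ∞ σ) :
    ContMDiff (𝓡 m) 𝓘(ℝ, Euc n →L[ℝ] W) ∞ (tder m φ σ) := by
  intro p
  have hp := mem_extChartAt_source (I := 𝓡 m) p
  have h := ((ContMDiffAt.comp_extChartAt_symm hp (hσ p)).fderiv_right (m := ∞)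
    (by simp)).clm_comp (hφ.contDiffAt_pinv_localRep hp)
  refine (ContMDiffAt.comp p h.contMDiffAt
    (contMDiffAt_extChartAt (I := 𝓡 m) (n := ∞))).congr_of_eventuallyEq ?_
  filter_upwards [(isOpen_extChartAt_source (I := 𝓡 m) p).mem_nhds hp] with q hq
  exact hφ.tder_eq hq (hσ.mdifferentiable (by simp) q)

theorem IsIsometricImmersion.contMDiff_tanProj (hφ : IsIsometricImmersion m φ) :
    ContMDiff (𝓡 m) 𝓘(ℝ, Euc n →L[ℝ] Euc n) ∞ (tanProj m φ) :=
  hφ.contMDiff_tder hφ.contMDiff_coe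

theorem IsIsometricImmersion.mdifferentiableAt_dphi_extendVec (hφ : IsIsometricImmersion m φ)
    {p : M} (v : TangentSpace (𝓡 m) p) :
    MDifferentiableAt (𝓡 m) 𝓘(ℝ, Euc n) (fun q => dphi m φ q (extendVec m v q)) p := by
  have hp := mem_extChartAt_source (I := 𝓡 m) p
  have h := ((hφ.contDiffAt_localRep hp).fderiv_right (m := ∞) (by simp)).clm_apply
    (contDiffAt_const (c := chartDeriv m p p v))
  refine ((ContMDiffAt.comp p h.contMDiffAt (contMDiffAt_extChartAt (I := 𝓡 m)
    (n := ∞))).congr_of_eventuallyEq ?_).mdifferentiableAt (by simp)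
  filter_upwards [(isOpen_extChartAt_source (I := 𝓡 m) p).mem_nhds hp] with q hq
  rw [hφ.dphi_eq_fderiv_localRep hq]
  exact congrArg _ (chartDeriv_extendVec hq v)

/-- The second derivative of `g` is symmetric and cancels. What remains is `dg` applied to the Lie
bracket of the vector fields `L · u` and `L · w`. -/
theorem fderiv_fderiv_comp_sub_swap {E V : Type*} [NormedAddCommGroup E] [NormedSpace ℝ E]
    [NormedAddCommGroup V] [NormedSpace ℝ V] {g : E → W} {L : E → V →L[ℝ] E} {x : E}
    (hg : ContDiffAt ℝ ∞ g x) (hL : DifferentiableAt ℝ L x) (u w : V) :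
    fderiv ℝ (fun y => fderiv ℝ g y ∘L L y) x (L x u) w -
      fderiv ℝ (fun y => fderiv ℝ g y ∘L L y) x (L x w) u =
      fderiv ℝ g x (fderiv ℝ L x (L x u) w - fderiv ℝ L x (L x w) u) := by
  have hgd : DifferentiableAt ℝ (fderiv ℝ g) x :=
    (hg.fderiv_right (m := ∞) (by simp)).differentiableAt (by simp)
  have hD : ∀ a b, fderiv ℝ (fun y => fderiv ℝ g y ∘L L y) x a b =
      fderiv ℝ g x (fderiv ℝ L x a b) + fderiv ℝ (fderiv ℝ g) x a (L x b) := by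
    intro a b
    rw [fderiv_clm_comp hgd hL]
    rfl
  have h2 : minSmoothness ℝ 2 ≤ ∞ := by
    rw [minSmoothness_of_isRCLikeNormedField]
    exact WithTop.coe_le_coe.2 (le_top (a := (2 : ℕ∞)))
  rw [hD, hD, (hg.isSymmSndFDerivAt h2).eq (L x u) (L x w), map_sub]
  abel

theorem IsIsometricImmersion.tder_tder_sub_swap_eq_fderiv (hφ : IsIsometricImmersion m φ)
    {σ : M → W} (hσ : ContMDiff (𝓡 m) 𝓘(ℝ, W) ∞ σ) (p : M) (u w : Euc n) :
    let x := extChartAt (𝓡 m) p p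
    let L := fun y => pinv (fderiv ℝ (localRep m φ p) y)
    tder m φ (tder m φ σ) p u w - tder m φ (tder m φ σ) p w u =
      fderiv ℝ (σ ∘ (extChartAt (𝓡 m) p).symm) x
        (fderiv ℝ L x (L x u) w - fderiv ℝ L x (L x w) u) := by
  intro x L
  have hp := mem_extChartAt_source (I := 𝓡 m) p
  have hloc : tder m φ σ ∘ (extChartAt (𝓡 m) p).symm =ᶠ[nhds x]
      fun y => fderiv ℝ (σ ∘ (extChartAt (𝓡 m) p).symm) y ∘L L y := by
    filter_upwards [(isOpen_extChartAt_target (I := 𝓡 m) p).mem_nhds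
      ((extChartAt (𝓡 m) p).map_source hp)] with y hy
    have := hφ.tder_eq ((extChartAt (𝓡 m) p).map_target hy)
      (hσ.mdifferentiable (by simp) ((extChartAt (𝓡 m) p).symm y))
    rwa [(extChartAt (𝓡 m) p).right_inv hy] at this
  rw [← fderiv_fderiv_comp_sub_swap (ContMDiffAt.comp_extChartAt_symm hp (hσ p))
    ((hφ.contDiffAt_pinv_localRep hp).differentiableAt (by simp)),
    hφ.tder_eq hp ((hφ.contMDiff_tder hσ).mdifferentiable (by simp) p), hloc.fderiv_eq]
  rfl

/-- The bracket in the chart does not depend on `σ`. Taking `σ = φ` expresses its image in `ℝⁿ⁺¹`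
through the derivative of `tanProj`, and `pinv` recovers the bracket from that image. -/
theorem IsIsometricImmersion.tder_tder_sub_swap (hφ : IsIsometricImmersion m φ) {σ : M → W}
    (hσ : ContMDiff (𝓡 m) 𝓘(ℝ, W) ∞ σ) (p : M) (u w : Euc n) :
    tder m φ (tder m φ σ) p u w - tder m φ (tder m φ σ) p w u =
      tder m φ σ p (tder m φ (tanProj m φ) p u w - tder m φ (tanProj m φ) p w u) := by
  have hp := mem_extChartAt_source (I := 𝓡 m) p
  have h : tder m φ (tanProj m φ) p u w - tder m φ (tanProj m φ) p w u = _ :=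
    hφ.tder_tder_sub_swap_eq_fderiv hφ.contMDiff_coe p u w
  rw [h, hφ.tder_tder_sub_swap_eq_fderiv hσ, hφ.tder_eq hp (hσ.mdifferentiable (by simp) p),
    ContinuousLinearMap.comp_apply]
  exact congrArg _ (pinv_apply_of_adjoint_eq (hφ.fderiv_localRep_injective hp) rfl).symm

end TangentialDerivative

theorem sphereProj_eq_self {n : ℕ} {x u : Euc n} (h : inner ℝ x u = (0 : ℝ)) :
    sphereProj x u = u := by
  rw [sphereProj, h, zero_smul, sub_zero]

/-! ### The second fundamental form as the derivative of the tangential projection. -/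

section SecondFundamentalForm

variable {m n : ℕ} {M : Type*} [TopologicalSpace M]
  [ChartedSpace (EuclideanSpace ℝ (Fin m)) M] [IsManifold (𝓡 m) ∞ M]
  [Bundle.RiemannianBundle (fun p : M => TangentSpace (𝓡 m) p)]
  {W W₁ W₂ : Type*} [NormedAddCommGroup W] [NormedSpace ℝ W] [NormedAddCommGroup W₁]
  [NormedSpace ℝ W₁] [NormedAddCommGroup W₂] [NormedSpace ℝ W₂]
  {φ : M → Sph n} {p : M}

theorem mvfderiv_clm_apply {A : M → W₁ →L[ℝ] W₂} {ρ : M → W₁}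
    (hA : MDifferentiableAt (𝓡 m) 𝓘(ℝ, W₁ →L[ℝ] W₂) A p)
    (hρ : MDifferentiableAt (𝓡 m) 𝓘(ℝ, W₁) ρ p) (v : TangentSpace (𝓡 m) p) :
    mvfderiv (𝓡 m) (fun q => A q (ρ q)) p v =
      A p (mvfderiv (𝓡 m) ρ p v) + mvfderiv (𝓡 m) A p v (ρ p) :=
  mvfderiv_bilinear (ContinuousLinearMap.id ℝ (W₁ →L[ℝ] W₂)) hA hρ v

theorem mvfderiv_clm_apply_const {A : M → W₁ →L[ℝ] W₂}
    (hA : MDifferentiableAt (𝓡 m) 𝓘(ℝ, W₁ →L[ℝ] W₂) A p) (w : W₁) (v : TangentSpace (𝓡 m) p) :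
    mvfderiv (𝓡 m) (fun q => A q w) p v = mvfderiv (𝓡 m) A p v w :=
  mvfderiv_clm_comp (ContinuousLinearMap.apply ℝ W₂ w) hA v

theorem mvfderiv_inner {σ ρ : M → Euc n} (hσ : MDifferentiableAt (𝓡 m) 𝓘(ℝ, Euc n) σ p)
    (hρ : MDifferentiableAt (𝓡 m) 𝓘(ℝ, Euc n) ρ p) (v : TangentSpace (𝓡 m) p) :
    mvfderiv (𝓡 m) (fun q => (inner ℝ (σ q) (ρ q) : ℝ)) p v =
      inner ℝ (σ p) (mvfderiv (𝓡 m) ρ p v) + inner ℝ (mvfderiv (𝓡 m) σ p v) (ρ p) :=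
  mvfderiv_bilinear (innerSL ℝ) hσ hρ v

theorem extendVec_self (v : TangentSpace (𝓡 m) p) : extendVec m v p = v :=
  FiberBundle.extend_apply_self _ v

theorem inner_coe_self (p : M) : inner ℝ (φ p : Euc n) (φ p : Euc n) = (1 : ℝ) := by
  rw [real_inner_self_eq_norm_sq, norm_eq_of_mem_sphere]
  norm_num

namespace IsIsometricImmersion

theorem mdifferentiableAt_coe (hφ : IsIsometricImmersion m φ) (p : M) :
    MDifferentiableAt (𝓡 m) 𝓘(ℝ, Euc n) (fun q => (φ q : Euc n)) p :=
  hφ.contMDiff_coe.mdifferentiable (by simp) p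

theorem mdifferentiableAt_tanProj (hφ : IsIsometricImmersion m φ) (p : M) :
    MDifferentiableAt (𝓡 m) 𝓘(ℝ, Euc n →L[ℝ] Euc n) (tanProj m φ) p :=
  hφ.contMDiff_tanProj.mdifferentiable (by simp) p

theorem inner_coe_dphi (hφ : IsIsometricImmersion m φ) (p : M) (v : TangentSpace (𝓡 m) p) :
    inner ℝ (φ p : Euc n) (dphi m φ p v) = (0 : ℝ) := by
  have h := mvfderiv_inner (hφ.mdifferentiableAt_coe p) (hφ.mdifferentiableAt_coe p) v
  have hc : (fun q => (inner ℝ (φ q : Euc n) (φ q : Euc n) : ℝ)) = fun _ => 1 :=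
    funext inner_coe_self
  rw [hc, mvfderiv_const, real_inner_comm, ← two_mul] at h
  rw [real_inner_comm]
  change (0 : ℝ) = 2 * inner ℝ (dphi m φ p v) (φ p : Euc n) at h
  linarith

theorem tangentPart_coe (hφ : IsIsometricImmersion m φ)
    (p : M) : tangentPart m φ p (φ p : Euc n) = 0 := by
  refine ext_inner_right ℝ fun v => ?_
  rw [inner_tangentPart, hφ.inner_coe_dphi, inner_zero_left]

theorem tanProj_coe (hφ : IsIsometricImmersion m φ) (p : M) : tanProj m φ p (φ p : Euc n) = 0 := by
  rw [tanProj_apply, hφ.tangentPart_coe, map_zero]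

theorem inner_coe_tanProj (hφ : IsIsometricImmersion m φ) (p : M) (u : Euc n) :
    inner ℝ (φ p : Euc n) (tanProj m φ p u) = (0 : ℝ) :=
  hφ.inner_coe_dphi p _

theorem tanProj_sphereProj (hφ : IsIsometricImmersion m φ) (p : M) (u : Euc n) :
    tanProj m φ p (sphereProj (φ p : Euc n) u) = tanProj m φ p u := by
  rw [sphereProj, map_sub, map_smul, hφ.tanProj_coe, smul_zero, sub_zero]

theorem normalPart_sphereProj (hφ : IsIsometricImmersion m φ) (p : M) (u : Euc n) :
    normalPart m φ p (sphereProj (φ p : Euc n) u) =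
      u - (inner ℝ (φ p : Euc n) u : ℝ) • (φ p : Euc n) - tanProj m φ p u := by
  have h : inner ℝ (φ p : Euc n) (sphereProj (φ p : Euc n) u) = (0 : ℝ) := by
    rw [sphereProj, inner_sub_right, inner_smul_right, inner_coe_self, mul_one, sub_self]
  rw [normalPart, ← tanProj_apply, hφ.tanProj_sphereProj, sphereProj_eq_self h,
    sphereProj]

/-- Differentiate `P² = P`. -/
theorem tder_tanProj_apply (hφ : IsIsometricImmersion m φ) (p : M) (u w : Euc n) :
    tder m φ (tanProj m φ) p u w =
      tder m φ (tanProj m φ) p u (tanProj m φ p w) + tanProj m φ p (tder m φ (tanProj m φ) p u w) := by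
  have hd := (hφ.mdifferentiableAt_tanProj p)
  have h := mvfderiv_clm_apply hd (hd.clm_apply (mdifferentiableAt_const (c := w)))
    (tangentPart m φ p u)
  simp only [hφ.tanProj_tanProj] at h
  rw [mvfderiv_clm_apply_const hd] at h
  exact h.trans (add_comm _ _)

/-- Differentiate `P φ = 0`, the derivative of `φ` along `u` being `P u`. -/
theorem tder_tanProj_coe (hφ : IsIsometricImmersion m φ) (p : M) (u : Euc n) :
    tder m φ (tanProj m φ) p u (φ p : Euc n) = -tanProj m φ p u := by
  have h := mvfderiv_clm_apply (hφ.mdifferentiableAt_tanProj p) (hφ.mdifferentiableAt_coe p)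
    (tangentPart m φ p u)
  simp only [hφ.tanProj_coe, mvfderiv_const] at h
  have h' : (0 : Euc n) = tanProj m φ p (tanProj m φ p u) +
    tder m φ (tanProj m φ) p u (φ p : Euc n) := h
  rw [hφ.tanProj_tanProj] at h'
  exact (neg_eq_of_add_eq_zero_right h'.symm).symm

/-- The derivative of a field of symmetric operators is symmetric. -/
theorem inner_tder_of_symm {A : M → Euc n →L[ℝ] Euc n}
    (hA : MDifferentiableAt (𝓡 m) 𝓘(ℝ, Euc n →L[ℝ] Euc n) A p)
    (hs : ∀ q x y, (inner ℝ (A q x) y : ℝ) = inner ℝ x (A q y)) (u x y : Euc n) :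
    (inner ℝ (tder m φ A p u x) y : ℝ) = inner ℝ x (tder m φ A p u y) := by
  have h₁ := mvfderiv_inner (hA.clm_apply (mdifferentiableAt_const (c := x)))
    (mdifferentiableAt_const (c := y)) (tangentPart m φ p u)
  have h₂ := mvfderiv_inner (mdifferentiableAt_const (c := x))
    (hA.clm_apply (mdifferentiableAt_const (c := y))) (tangentPart m φ p u)
  simp only [hs] at h₁
  rw [h₁, mvfderiv_const, mvfderiv_const, mvfderiv_clm_apply_const hA,
    mvfderiv_clm_apply_const hA] at h₂
  simpa [tder_apply] using h₂

theorem inner_tder_tanProj (hφ : IsIsometricImmersion m φ) (p : M) (u x y : Euc n) :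
    (inner ℝ (tder m φ (tanProj m φ) p u x) y : ℝ) = inner ℝ x (tder m φ (tanProj m φ) p u y) :=
  inner_tder_of_symm (hφ.mdifferentiableAt_tanProj p) (fun _ => inner_tanProj _) u x y

theorem tanProj_tder_tanProj (hφ : IsIsometricImmersion m φ) (p : M) (u w : Euc n) :
    tanProj m φ p (tder m φ (tanProj m φ) p u (tanProj m φ p w)) = 0 := by
  have h := hφ.tder_tanProj_apply p u (tanProj m φ p w)
  rw [hφ.tanProj_tanProj] at h
  exact left_eq_add.1 h

/-- This is the symmetry of `B`. The commutator formula for `σ = φ` shows that `(D_u P) w - (D_w P)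
u` is tangential, and `(D_u P)(P w)` is the part of `(D_u P) w` annihilated by `P`. -/
theorem tder_tanProj_symm (hφ : IsIsometricImmersion m φ) (p : M) (u w : Euc n) :
    tder m φ (tanProj m φ) p u (tanProj m φ p w) = tder m φ (tanProj m φ) p w (tanProj m φ p u) := by
  have h : tder m φ (tanProj m φ) p u w - tder m φ (tanProj m φ) p w u =
      tanProj m φ p (tder m φ (tanProj m φ) p u w - tder m φ (tanProj m φ) p w u) :=
    hφ.tder_tder_sub_swap hφ.contMDiff_coe p u w
  have h₁ := hφ.tder_tanProj_apply p u w
  have h₂ := hφ.tder_tanProj_apply p w u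
  rw [map_sub] at h
  rw [eq_sub_of_add_eq h₁.symm, eq_sub_of_add_eq h₂.symm, sub_eq_sub_iff_sub_eq_sub]
  exact h

/-- The derivative of a tangent vector field. -/
theorem mvfderiv_dphi (hφ : IsIsometricImmersion m φ) {X : Π q : M, TangentSpace (𝓡 m) q}
    (hX : MDifferentiableAt (𝓡 m) 𝓘(ℝ, Euc n) (fun q => dphi m φ q (X q)) p)
    (v : TangentSpace (𝓡 m) p) :
    mvfderiv (𝓡 m) (fun q => dphi m φ q (X q)) p v =
      tder m φ (tanProj m φ) p (dphi m φ p v) (dphi m φ p (X p)) +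
        tanProj m φ p (mvfderiv (𝓡 m) (fun q => dphi m φ q (X q)) p v) := by
  have h := mvfderiv_clm_apply (hφ.mdifferentiableAt_tanProj p) hX v
  simp only [hφ.tanProj_dphi] at h
  rw [hφ.tder_dphi]
  exact h.trans (add_comm _ _)

theorem dphi_leviCivita (hφ : IsIsometricImmersion m φ)
    (X : Π q : M, TangentSpace (𝓡 m) q) (v : TangentSpace (𝓡 m) p) :
    dphi m φ p (leviCivita m φ X p v) =
      tanProj m φ p (mvfderiv (𝓡 m) (fun q => dphi m φ q (X q)) p v) := by
  rw [leviCivita, ← tanProj_apply, pullbackConn, hφ.tanProj_sphereProj]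
  rfl

theorem inner_coe_tder_tanProj (hφ : IsIsometricImmersion m φ) (p : M) (u w : Euc n) :
    (inner ℝ (φ p : Euc n) (tder m φ (tanProj m φ) p u w) : ℝ) = -inner ℝ (tanProj m φ p u) w := by
  rw [← hφ.inner_tder_tanProj, hφ.tder_tanProj_coe, inner_neg_left]

/-- `(D_v P) w` is the component of the derivative of `dφ W` normal to `M` in `ℝⁿ⁺¹`. Its part along
`φ` is `-⟨v, w⟩ φ`, which the projection to `TSⁿ` removes. -/
theorem secondFF_eq (hφ : IsIsometricImmersion m φ) (v w : TangentSpace (𝓡 m) p) :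
    secondFF m φ p v w = tder m φ (tanProj m φ) p (dphi m φ p v) (dphi m φ p w) +
      (inner ℝ (dphi m φ p v) (dphi m φ p w) : ℝ) • (φ p : Euc n) := by
  have h := hφ.mvfderiv_dphi (hφ.mdifferentiableAt_dphi_extendVec w) v
  rw [secondFF, pullbackConn, hφ.normalPart_sphereProj, dirDeriv]
  rw [extendVec_self] at h
  set z := mvfderiv (𝓡 m) (fun q => dphi m φ q (extendVec m w q)) p v
  have hf : (inner ℝ (φ p : Euc n) z : ℝ) = -inner ℝ (dphi m φ p v) (dphi m φ p w) := by
    rw [h, inner_add_right, hφ.inner_coe_tanProj, hφ.inner_coe_tder_tanProj, hφ.tanProj_dphi,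
      add_zero]
  rw [hf, eq_sub_of_add_eq h.symm]
  module

theorem nablaDphi_eq (hφ : IsIsometricImmersion m φ) (v w : TangentSpace (𝓡 m) p) :
    nablaDphi m φ p v w = secondFF m φ p v w := by
  rw [nablaDphi, hφ.dphi_leviCivita, secondFF, pullbackConn, hφ.normalPart_sphereProj]
  rfl

theorem tension_eq (hφ : IsIsometricImmersion m φ)
    (p : M) : tension m φ p = trace m p (secondFF m φ p) := by
  simp only [tension, trace, hφ.nablaDphi_eq]

/-- Traces over `T_pM` computed with the tangential parts of an orthonormal basis of `ℝⁿ⁺¹`. -/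
theorem trace_dphi (hφ : IsIsometricImmersion m φ)
    {ι : Type*} [Fintype ι] (b : OrthonormalBasis ι ℝ (Euc n))
    (β : Euc n →L[ℝ] Euc n →L[ℝ] W) (p : M) :
    trace m p (fun v w => β (dphi m φ p v) (dphi m φ p w)) =
      ∑ k, β (tanProj m φ p (b k)) (tanProj m φ p (b k)) := by
  classical
  set e := frame m p
  have hk : ∀ k, tanProj m φ p (b k) =
      ∑ i, (inner ℝ (dphi m φ p (e i)) (b k) : ℝ) • dphi m φ p (e i) := by
    intro k
    rw [tanProj_apply, ← e.sum_repr' (tangentPart m φ p (b k))]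
    simp only [map_sum, map_smul]
    refine Finset.sum_congr rfl fun i _ => ?_
    rw [real_inner_comm, inner_tangentPart, real_inner_comm]
  -- Parseval for `b`, since `dφ` carries the frame to an orthonormal family.
  have hon : ∀ i j, ∑ k, (inner ℝ (dphi m φ p (e i)) (b k) : ℝ) * inner ℝ (dphi m φ p (e j)) (b k) =
      if i = j then 1 else 0 := by
    intro i j
    have := b.sum_inner_mul_inner (dphi m φ p (e i)) (dphi m φ p (e j))
    rw [hφ.inner_dphi, orthonormal_iff_ite.1 e.orthonormal] at this
    rw [← this]
    exact Finset.sum_congr rfl fun k _ => by rw [real_inner_comm (b k) (dphi m φ p (e j))]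
  simp only [hk, map_sum, map_smul, sum_apply, smul_apply,
    Finset.smul_sum, smul_smul]
  rw [Finset.sum_comm]
  rw [trace]
  refine Finset.sum_congr rfl fun i _ => ?_
  rw [Finset.sum_comm]
  simp only [← Finset.sum_smul, hon]
  simp [e]

theorem trace_inner_self (p : M) :
    trace m p (fun v w : TangentSpace (𝓡 m) p => (inner ℝ v w : ℝ)) = m := by
  have h : Module.finrank ℝ (TangentSpace (𝓡 m) p) = m :=
    (finrank_euclideanSpace_fin (𝕜 := ℝ) (n := m) :)
  simp [trace, h]

end IsIsometricImmersion

end SecondFundamentalForm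

/-! ### The curvature tensor of the unit sphere. -/

section SphereCurvature

variable {n : ℕ}

theorem hasFDerivAt_sphereProj {z : Euc n → Euc n} {z' : Euc n →L[ℝ] Euc n} {x : Euc n}
    (hz : HasFDerivAt z z' x) (u : Euc n) :
    DifferentiableAt ℝ (fun y => sphereProj y (z y)) x ∧
      fderiv ℝ (fun y => sphereProj y (z y)) x u =
        z' u - ((inner ℝ x (z x) : ℝ) • u + (inner ℝ x (z' u) + inner ℝ u (z x) : ℝ) • x) := by
  have h := hz.sub (((hasFDerivAt_id x).inner ℝ hz).smul (hasFDerivAt_id x))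
  refine ⟨h.differentiableAt, ?_⟩
  have h' : fderiv ℝ (fun y => sphereProj y (z y)) x = _ := h.fderiv
  rw [h']
  simp

theorem fderiv_sphereProj_const (w y h : Euc n) :
    fderiv ℝ (fun y => sphereProj y w) y h =
      -((inner ℝ y w : ℝ) • h + (inner ℝ h w : ℝ) • y) := by
  rw [(hasFDerivAt_sphereProj (hasFDerivAt_const w y) h).2]
  simp

theorem sphereConn_sphereConn {x u v w : Euc n} (hx : inner ℝ x x = (1 : ℝ))
    (hu : inner ℝ x u = (0 : ℝ)) (hv : inner ℝ x v = (0 : ℝ)) (hw : inner ℝ x w = (0 : ℝ)) :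
    sphereConn (fun y => sphereProj y u)
      (sphereConn (fun y => sphereProj y v) (fun y => sphereProj y w)) x =
      -(inner ℝ u w : ℝ) • v := by
  set V : Euc n → Euc n := fun y => sphereProj y v with hV
  have hVx : V x = v := sphereProj_eq_self hv
  set z : Euc n → Euc n := fun y => -((inner ℝ y w : ℝ) • V y + (inner ℝ (V y) w : ℝ) • y) with hz
  have hconn : sphereConn V (fun y => sphereProj y w) = fun y => sphereProj y (z y) := by
    ext1 y
    rw [sphereConn, fderiv_sphereProj_const]
  have hVd : HasFDerivAt V (fderiv ℝ V x) x :=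
    (hasFDerivAt_sphereProj (hasFDerivAt_const v x) 0).1.hasFDerivAt
  have hzd := ((((hasFDerivAt_id x).inner ℝ (hasFDerivAt_const w x)).smul hVd).add
    ((hVd.inner ℝ (hasFDerivAt_const w x)).smul (hasFDerivAt_id x))).neg
  have hzx : z x = -(inner ℝ v w : ℝ) • x := by
    simp only [hz, hVx, hw]
    module
  rw [hconn, sphereConn, sphereProj_eq_self hu, (hasFDerivAt_sphereProj (z := z) hzd u).2, hzx]
  simp only [sphereProj, inner_sub_right, inner_add_right, inner_smul_right, inner_neg_right, hx,
    hu, hv, hw, hVx, neg_apply, add_apply,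
    smul_apply, ContinuousLinearMap.smulRight_apply, id_eq,
    ContinuousLinearMap.comp_apply, ContinuousLinearMap.prod_apply, fderivInnerCLM_apply,
    ContinuousLinearMap.id_apply, zero_apply, inner_zero_right]
  module

/-- The sphere has constant sectional curvature one. -/
theorem sphereCurvature_eq {x u v w : Euc n} (hx : inner ℝ x x = (1 : ℝ))
    (hu : inner ℝ x u = (0 : ℝ)) (hv : inner ℝ x v = (0 : ℝ)) (hw : inner ℝ x w = (0 : ℝ)) :
    sphereCurvature x u v w = (inner ℝ v w : ℝ) • u - (inner ℝ u w : ℝ) • v := by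
  -- At `x` each field has derivative `-⟨u, v⟩ x` along the other, so the bracket vanishes there.
  have hbr : VectorField.lieBracket ℝ (fun y => sphereProj y u) (fun y => sphereProj y v) x = 0 := by
    rw [VectorField.lieBracket, fderiv_sphereProj_const, fderiv_sphereProj_const,
      sphereProj_eq_self hu, sphereProj_eq_self hv, hu, hv, real_inner_comm]
    simp
  rw [sphereCurvature, sphereConn_sphereConn hx hu hv hw, sphereConn_sphereConn hx hv hu hw,
    sphereConn, hbr, map_zero, sphereProj, inner_zero_right]
  module

end SphereCurvature

/-! ### The shape operator of a parallel mean curvature vector, and the Codazzi equation. -/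

section MeanCurvature

variable {m n : ℕ} {M : Type*} [TopologicalSpace M]
  [ChartedSpace (EuclideanSpace ℝ (Fin m)) M] [IsManifold (𝓡 m) ∞ M]
  [Bundle.RiemannianBundle (fun p : M => TangentSpace (𝓡 m) p)]
  {φ : M → Sph n} {p : M}

/-- The operator `-dH` of `ℝⁿ⁺¹`, extended by zero on the normal vectors of `M`; if `H` is
parallel, it is the operator `A_H` on the tangent vectors. -/
def shapeOp (m : ℕ) {M : Type*} [TopologicalSpace M]
    [ChartedSpace (EuclideanSpace ℝ (Fin m)) M] [IsManifold (𝓡 m) ∞ M]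
    [Bundle.RiemannianBundle (fun p : M => TangentSpace (𝓡 m) p)] (φ : M → Sph n) (p : M) :
    Euc n →L[ℝ] Euc n :=
  -tder m φ (meanCurv m φ) p

namespace IsIsometricImmersion

theorem tanProj_secondFF (hφ : IsIsometricImmersion m φ) (v w : TangentSpace (𝓡 m) p) :
    tanProj m φ p (secondFF m φ p v w) = 0 := by
  rw [hφ.secondFF_eq, map_add, map_smul, hφ.tanProj_coe, smul_zero, add_zero,
    ← hφ.tanProj_dphi p w, hφ.tanProj_tder_tanProj]

theorem inner_coe_secondFF (hφ : IsIsometricImmersion m φ) (v w : TangentSpace (𝓡 m) p) :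
    inner ℝ (φ p : Euc n) (secondFF m φ p v w) = (0 : ℝ) := by
  rw [hφ.secondFF_eq, inner_add_right, inner_smul_right, inner_coe_self, hφ.inner_coe_tder_tanProj,
    hφ.tanProj_dphi, mul_one, neg_add_cancel]

theorem tanProj_meanCurv (hφ : IsIsometricImmersion m φ)
    (p : M) : tanProj m φ p (meanCurv m φ p) = 0 := by
  simp only [meanCurv, trace, map_smul, map_sum, hφ.tanProj_secondFF, Finset.sum_const_zero,
    smul_zero]

theorem inner_coe_meanCurv (hφ : IsIsometricImmersion m φ)
    (p : M) : inner ℝ (φ p : Euc n) (meanCurv m φ p) = (0 : ℝ) := by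
  simp only [meanCurv, trace, inner_smul_right, inner_sum, hφ.inner_coe_secondFF,
    Finset.sum_const_zero, mul_zero]

/-- The frame in `trace` is chosen point by point and need not vary smoothly; a fixed basis of
`ℝⁿ⁺¹` makes the smoothness of `H` visible. -/
theorem meanCurv_eq (hφ : IsIsometricImmersion m φ) (p : M) : meanCurv m φ p = (m : ℝ)⁻¹ •
    ∑ k, (tder m φ (tanProj m φ) p (tanProj m φ p (EuclideanSpace.basisFun (Fin (n + 1)) ℝ k))
      (tanProj m φ p (EuclideanSpace.basisFun (Fin (n + 1)) ℝ k)) +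
      (inner ℝ (tanProj m φ p (EuclideanSpace.basisFun (Fin (n + 1)) ℝ k))
        (tanProj m φ p (EuclideanSpace.basisFun (Fin (n + 1)) ℝ k)) : ℝ) • (φ p : Euc n)) := by
  rw [meanCurv]
  congr 1
  have := hφ.trace_dphi (EuclideanSpace.basisFun (Fin (n + 1)) ℝ) (tder m φ (tanProj m φ) p +
    (ContinuousLinearMap.smulRightL ℝ (Euc n) (Euc n)).flip (φ p : Euc n) ∘L (innerSL ℝ)) p
  convert! this using 1
  congr 1
  ext1 v
  ext1 w
  exact hφ.secondFF_eq v w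

theorem contMDiff_meanCurv (hφ : IsIsometricImmersion m φ)
    : ContMDiff (𝓡 m) 𝓘(ℝ, Euc n) ∞ (meanCurv m φ) := by
  have hP := hφ.contMDiff_tanProj
  have hk : ∀ u : Euc n, ContMDiff (𝓡 m) 𝓘(ℝ, Euc n) ∞ (fun q => tanProj m φ q u) :=
    fun u => hP.clm_apply contMDiff_const
  have hi : ∀ u : Euc n, ContMDiff (𝓡 m) 𝓘(ℝ, ℝ) ∞
      (fun q => (inner ℝ (tanProj m φ q u) (tanProj m φ q u) : ℝ)) :=
    fun u => (ContDiff.inner ℝ (contDiff_id (E := Euc n)) contDiff_id).contMDiff.comp (hk u)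
  rw [funext hφ.meanCurv_eq]
  refine (contDiff_const_smul (m : ℝ)⁻¹).contMDiff.comp ?_
  refine contMDiff_finsetSum fun k _ => ?_
  exact (((hφ.contMDiff_tder hP).clm_apply (hk _)).clm_apply (hk _)).add
    ((hi _).smul hφ.contMDiff_coe)

theorem contMDiff_shapeOp (hφ : IsIsometricImmersion m φ)
    : ContMDiff (𝓡 m) 𝓘(ℝ, Euc n →L[ℝ] Euc n) ∞ (shapeOp m φ) :=
  (hφ.contMDiff_tder hφ.contMDiff_meanCurv).neg

theorem mdifferentiableAt_shapeOp (hφ : IsIsometricImmersion m φ) (p : M) :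
    MDifferentiableAt (𝓡 m) 𝓘(ℝ, Euc n →L[ℝ] Euc n) (shapeOp m φ) p :=
  hφ.contMDiff_shapeOp.mdifferentiable (by simp) p

theorem mdifferentiableAt_meanCurv (hφ : IsIsometricImmersion m φ) (p : M) :
    MDifferentiableAt (𝓡 m) 𝓘(ℝ, Euc n) (meanCurv m φ) p :=
  hφ.contMDiff_meanCurv.mdifferentiable (by simp) p

theorem mvfderiv_meanCurv (hφ : IsIsometricImmersion m φ) (v : TangentSpace (𝓡 m) p) :
    mvfderiv (𝓡 m) (meanCurv m φ) p v = -shapeOp m φ p (dphi m φ p v) := by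
  rw [shapeOp, neg_apply, neg_neg, hφ.tder_dphi]

theorem shapeOp_tanProj (hφ : IsIsometricImmersion m φ) (p : M) (u : Euc n) :
    shapeOp m φ p (tanProj m φ p u) = shapeOp m φ p u := by
  rw [shapeOp, neg_apply, neg_apply, hφ.tder_tanProj]

/-- Differentiate `P H = 0`. -/
theorem tanProj_shapeOp_eq_tder (hφ : IsIsometricImmersion m φ) (p : M) (u : Euc n) :
    tanProj m φ p (shapeOp m φ p u) = tder m φ (tanProj m φ) p u (meanCurv m φ p) := by
  have h := mvfderiv_clm_apply (hφ.mdifferentiableAt_tanProj p) (hφ.mdifferentiableAt_meanCurv p)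
    (tangentPart m φ p u)
  simp only [hφ.tanProj_meanCurv, mvfderiv_const] at h
  rw [hφ.mvfderiv_meanCurv, ← tanProj_apply, hφ.shapeOp_tanProj, map_neg] at h
  exact (neg_add_eq_zero.1 h.symm)

/-- Parallelism removes the component of `DH` normal to `M` in `Sⁿ`. The component along `φ`
vanishes on differentiating `⟨φ, H⟩ = 0`, because `H` is orthogonal to `dφ`. -/
theorem tanProj_shapeOp (hφ : IsIsometricImmersion m φ) (hH : HasParallelMeanCurv m φ)
    (p : M) (u : Euc n) :
    tanProj m φ p (shapeOp m φ p u) = shapeOp m φ p u := by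
  have h := hH p (tangentPart m φ p u)
  rw [normalConn, pullbackConn, hφ.normalPart_sphereProj, dirDeriv, hφ.mvfderiv_meanCurv,
    ← tanProj_apply, hφ.shapeOp_tanProj] at h
  have hi := mvfderiv_inner (hφ.mdifferentiableAt_coe p) (hφ.mdifferentiableAt_meanCurv p)
    (tangentPart m φ p u)
  simp only [hφ.inner_coe_meanCurv, mvfderiv_const] at hi
  rw [hφ.mvfderiv_meanCurv, ← tanProj_apply, hφ.shapeOp_tanProj] at hi
  have hi' : (0 : ℝ) = inner ℝ (φ p : Euc n) (-shapeOp m φ p u) +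
    inner ℝ (tanProj m φ p u) (meanCurv m φ p) := hi
  rw [inner_tanProj, hφ.tanProj_meanCurv, inner_zero_right, add_zero] at hi'
  rw [← hi', zero_smul, sub_zero, map_neg, sub_eq_zero, neg_inj] at h
  exact h.symm

theorem tder_tanProj_meanCurv (hφ : IsIsometricImmersion m φ) (hH : HasParallelMeanCurv m φ)
    (p : M) (u : Euc n) :
    tder m φ (tanProj m φ) p u (meanCurv m φ p) = shapeOp m φ p u := by
  rw [← hφ.tanProj_shapeOp_eq_tder, hφ.tanProj_shapeOp hH]

theorem inner_shapeOp_eq_inner_meanCurv (hφ : IsIsometricImmersion m φ)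
    (hH : HasParallelMeanCurv m φ)
    (p : M) (u w : Euc n) :
    (inner ℝ (shapeOp m φ p u) w : ℝ) =
      inner ℝ (tder m φ (tanProj m φ) p u (tanProj m φ p w)) (meanCurv m φ p) := by
  rw [hφ.inner_tder_tanProj, hφ.tder_tanProj_meanCurv hH, inner_tanProj, hφ.tanProj_shapeOp hH,
    real_inner_comm]

theorem inner_shapeOp (hφ : IsIsometricImmersion m φ) (hH : HasParallelMeanCurv m φ)
    (p : M) (u w : Euc n) :
    (inner ℝ (shapeOp m φ p u) w : ℝ) = inner ℝ u (shapeOp m φ p w) := by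
  rw [hφ.inner_shapeOp_eq_inner_meanCurv hH, hφ.tder_tanProj_symm,
    ← hφ.inner_shapeOp_eq_inner_meanCurv hH, real_inner_comm]

theorem inner_tder_shapeOp (hφ : IsIsometricImmersion m φ) (hH : HasParallelMeanCurv m φ)
    (p : M) (u x y : Euc n) :
    (inner ℝ (tder m φ (shapeOp m φ) p u x) y : ℝ) = inner ℝ x (tder m φ (shapeOp m φ) p u y) :=
  inner_tder_of_symm (hφ.mdifferentiableAt_shapeOp p) (hφ.inner_shapeOp hH) u x y

theorem inner_secondFF_meanCurv (hφ : IsIsometricImmersion m φ) (hH : HasParallelMeanCurv m φ)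
    (v w : TangentSpace (𝓡 m) p) :
    (inner ℝ (secondFF m φ p v w) (meanCurv m φ p) : ℝ) =
      inner ℝ (shapeOp m φ p (dphi m φ p v)) (dphi m φ p w) := by
  rw [hφ.inner_shapeOp_eq_inner_meanCurv hH, hφ.tanProj_dphi, hφ.secondFF_eq, inner_add_left,
    inner_smul_left, hφ.inner_coe_meanCurv, mul_zero, add_zero]

theorem AH_eq (hφ : IsIsometricImmersion m φ) (hH : HasParallelMeanCurv m φ)
    (v : TangentSpace (𝓡 m) p) :
    AH m φ p v = tangentPart m φ p (shapeOp m φ p (dphi m φ p v)) := by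
  rw [AH, weingarten, ← (frame m p).sum_repr' (tangentPart m φ p _)]
  refine Finset.sum_congr rfl fun i _ => ?_
  rw [hφ.inner_secondFF_meanCurv hH, real_inner_comm _ (frame m p i), inner_tangentPart]

theorem dphi_AH (hφ : IsIsometricImmersion m φ) (hH : HasParallelMeanCurv m φ)
    (v : TangentSpace (𝓡 m) p) :
    dphi m φ p (AH m φ p v) = shapeOp m φ p (dphi m φ p v) := by
  rw [hφ.AH_eq hH, ← tanProj_apply, hφ.tanProj_shapeOp hH]

theorem shapeOp_meanCurv (hφ : IsIsometricImmersion m φ)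
    (p : M) : shapeOp m φ p (meanCurv m φ p) = 0 := by
  rw [← hφ.shapeOp_tanProj, hφ.tanProj_meanCurv, map_zero]

/-- Differentiate `S H = 0` and use `D_u H = -S u`. -/
theorem tder_shapeOp_meanCurv (hφ : IsIsometricImmersion m φ)
    (p : M) (u : Euc n) :
    tder m φ (shapeOp m φ) p u (meanCurv m φ p) = shapeOp m φ p (shapeOp m φ p u) := by
  have h := mvfderiv_clm_apply (hφ.mdifferentiableAt_shapeOp p) (hφ.mdifferentiableAt_meanCurv p)
    (tangentPart m φ p u)
  simp only [hφ.shapeOp_meanCurv, mvfderiv_const] at h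
  rw [hφ.mvfderiv_meanCurv, ← tanProj_apply, hφ.shapeOp_tanProj, map_neg] at h
  exact (neg_add_eq_zero.1 h.symm).symm

/-- The Codazzi equation in the direction of `H`. -/
theorem tder_shapeOp_symm (hφ : IsIsometricImmersion m φ)
    (p : M) (u w : Euc n) :
    tder m φ (shapeOp m φ) p (tanProj m φ p u) (tanProj m φ p w) =
      tder m φ (shapeOp m φ) p (tanProj m φ p w) (tanProj m φ p u) := by
  have h := hφ.tder_tder_sub_swap hφ.contMDiff_meanCurv p (tanProj m φ p u) (tanProj m φ p w)
  have hs := hφ.tder_tanProj_symm p (tanProj m φ p u) (tanProj m φ p w)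
  rw [hφ.tanProj_tanProj, hφ.tanProj_tanProj] at hs
  -- The bracket term in the commutator vanishes on tangential arguments, by the symmetry of `B`.
  rw [hs, sub_self, map_zero, sub_eq_zero] at h
  have hneg : ∀ a, tder m φ (shapeOp m φ) p a = -tder m φ (tder m φ (meanCurv m φ)) p a := by
    intro a
    have : shapeOp m φ = -tder m φ (meanCurv m φ) := rfl
    rw [tder_apply, this, mvfderiv_neg]
    rfl
  rw [hneg, hneg, neg_apply, neg_apply, h]

theorem mvfderiv_shapeOp_dphi (hφ : IsIsometricImmersion m φ)
    {X : Π q : M, TangentSpace (𝓡 m) q}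
    (hX : MDifferentiableAt (𝓡 m) 𝓘(ℝ, Euc n) (fun q => dphi m φ q (X q)) p)
    (v : TangentSpace (𝓡 m) p) :
    mvfderiv (𝓡 m) (fun q => shapeOp m φ q (dphi m φ q (X q))) p v =
      shapeOp m φ p (dphi m φ p (leviCivita m φ X p v)) +
        tder m φ (shapeOp m φ) p (dphi m φ p v) (dphi m φ p (X p)) := by
  rw [mvfderiv_clm_apply (hφ.mdifferentiableAt_shapeOp p) hX, hφ.dphi_leviCivita,
    hφ.shapeOp_tanProj, hφ.tder_dphi]

theorem dphi_nablaAH (hφ : IsIsometricImmersion m φ) (hH : HasParallelMeanCurv m φ)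
    (v w : TangentSpace (𝓡 m) p) :
    dphi m φ p (nablaAH m φ p v w) =
      tanProj m φ p (tder m φ (shapeOp m φ) p (dphi m φ p v) (dphi m φ p w)) := by
  rw [nablaAH, map_sub, hφ.dphi_leviCivita, hφ.dphi_AH hH]
  simp only [hφ.dphi_AH hH]
  rw [hφ.mvfderiv_shapeOp_dphi (hφ.mdifferentiableAt_dphi_extendVec w), map_add,
    hφ.tanProj_shapeOp hH, add_sub_cancel_left, extendVec_self]

/-- Differentiate `⟨B(V, W), H⟩ = ⟨S V, W⟩`. The term with `DH` drops out because `DH` is tangential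
and `B` is normal; the terms with `∇V` and `∇W` are those subtracted in `nablaB`. -/
theorem inner_nablaB_meanCurv (hφ : IsIsometricImmersion m φ) (hH : HasParallelMeanCurv m φ)
    (u v w : TangentSpace (𝓡 m) p) :
    (inner ℝ (nablaB m φ p u v w) (meanCurv m φ p) : ℝ) =
      inner ℝ (tder m φ (shapeOp m φ) p (dphi m φ p u) (dphi m φ p v)) (dphi m φ p w) := by
  have hV := hφ.mdifferentiableAt_dphi_extendVec v
  have hW := hφ.mdifferentiableAt_dphi_extendVec w
  have hB : MDifferentiableAt (𝓡 m) 𝓘(ℝ, Euc n)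
      (fun q => secondFF m φ q (extendVec m v q) (extendVec m w q)) p := by
    simp only [hφ.secondFF_eq]
    exact ((((hφ.contMDiff_tder hφ.contMDiff_tanProj).mdifferentiable (by simp) p).clm_apply
      hV).clm_apply hW).add
      ((MDifferentiableAt.bilinear (innerSL ℝ) hV hW).smul (hφ.mdifferentiableAt_coe p))
  have hsA : MDifferentiableAt (𝓡 m) 𝓘(ℝ, Euc n)
      (fun q => shapeOp m φ q (dphi m φ q (extendVec m v q))) p :=
    (hφ.mdifferentiableAt_shapeOp p).clm_apply hV
  have h₁ := mvfderiv_inner hB (hφ.mdifferentiableAt_meanCurv p) u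
  simp only [hφ.inner_secondFF_meanCurv hH] at h₁
  rw [mvfderiv_inner hsA hW, hφ.mvfderiv_shapeOp_dphi hV, hφ.mvfderiv_meanCurv,
    ← hφ.tanProj_shapeOp hH p (dphi m φ p u), inner_neg_right, ← inner_tanProj,
    hφ.tanProj_secondFF, inner_zero_left, neg_zero, zero_add, extendVec_self, extendVec_self,
    ← hφ.tanProj_shapeOp hH p (dphi m φ p v), inner_tanProj, ← hφ.dphi_leviCivita,
    inner_add_left] at h₁
  rw [nablaB, inner_sub_left, inner_sub_left, hφ.inner_secondFF_meanCurv hH,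
    hφ.inner_secondFF_meanCurv hH, normalConn, pullbackConn, hφ.normalPart_sphereProj,
    inner_sub_left, inner_sub_left, inner_smul_left, hφ.inner_coe_meanCurv, inner_tanProj,
    hφ.tanProj_meanCurv, inner_zero_right, mul_zero, sub_zero, sub_zero]
  change inner ℝ (mvfderiv (𝓡 m) _ p u) _ - _ - _ = _
  linarith

end IsIsometricImmersion

end MeanCurvature

/-! ### The biharmonic equation and its consequences. -/

section Biharmonic

variable {m n : ℕ} {M : Type*} [TopologicalSpace M]
  [ChartedSpace (EuclideanSpace ℝ (Fin m)) M] [IsManifold (𝓡 m) ∞ M]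
  [Bundle.RiemannianBundle (fun p : M => TangentSpace (𝓡 m) p)]
  {φ : M → Sph n} {p : M}

/-- In dimension zero every trace is an empty sum, so `φ` would be harmonic. This makes the factor
`m⁻¹` in `H` a genuine inverse. -/
theorem IsProperBiharmonic.dim_ne_zero (hbi : IsProperBiharmonic m φ) : (m : ℝ) ≠ 0 := by
  intro hm
  refine hbi.2 fun p => ?_
  have hm' : m = 0 := by exact_mod_cast hm
  have h : Module.finrank ℝ (TangentSpace (𝓡 m) p) = 0 :=
    (finrank_euclideanSpace_fin (𝕜 := ℝ) (n := m) :).trans hm'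
  have : IsEmpty (Fin (Module.finrank ℝ (TangentSpace (𝓡 m) p))) := by
    rw [h]
    infer_instance
  rw [tension, trace, Finset.univ_eq_empty, Finset.sum_empty]

theorem mvfderiv_sum {W ι : Type*} [NormedAddCommGroup W] [NormedSpace ℝ W] (s : Finset ι)
    {σ : ι → M → W} (hσ : ∀ i, MDifferentiableAt (𝓡 m) 𝓘(ℝ, W) (σ i) p)
    (v : TangentSpace (𝓡 m) p) :
    MDifferentiableAt (𝓡 m) 𝓘(ℝ, W) (fun q => ∑ i ∈ s, σ i q) p ∧
      mvfderiv (𝓡 m) (fun q => ∑ i ∈ s, σ i q) p v = ∑ i ∈ s, mvfderiv (𝓡 m) (σ i) p v := by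
  classical
  induction s using Finset.induction_on with
  | empty => simp [mvfderiv_const, mdifferentiableAt_const]
  | insert i s hi ih =>
    simp only [Finset.sum_insert hi]
    refine ⟨(hσ i).add ih.1, ?_⟩
    rw [← ih.2]
    exact congrArg (fun L => L v) (mvfderiv_add (hσ i) ih.1)

namespace IsIsometricImmersion

theorem tension_eq_smul_meanCurv (hφ : IsIsometricImmersion m φ) (hm : (m : ℝ) ≠ 0) :
    tension m φ = fun q => (m : ℝ) • meanCurv m φ q := by
  ext1 p
  rw [hφ.tension_eq, meanCurv, smul_inv_smul₀ hm]

/-- In `R(v, τ)w = ⟨τ, w⟩ v - ⟨v, w⟩ τ` the first term vanishes because `τ` is normal. One factor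
`m` is `trace ⟨·, ·⟩`, the other comes from `τ = mH`. -/
theorem trace_sphereCurvature_tension (hφ : IsIsometricImmersion m φ) (hm : (m : ℝ) ≠ 0) (p : M) :
    trace m p (fun v w => sphereCurvature (φ p : Euc n) (dphi m φ p v) (tension m φ p)
      (dphi m φ p w)) = -((m : ℝ) • (m : ℝ) • meanCurv m φ p) := by
  have h : ∀ v w : TangentSpace (𝓡 m) p, sphereCurvature (φ p : Euc n) (dphi m φ p v)
      (tension m φ p) (dphi m φ p w) = -((inner ℝ v w : ℝ) • (m : ℝ) • meanCurv m φ p) := by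
    intro v w
    rw [hφ.tension_eq_smul_meanCurv hm]
    rw [sphereCurvature_eq (inner_coe_self p) (hφ.inner_coe_dphi p v)
      (by rw [inner_smul_right, hφ.inner_coe_meanCurv, mul_zero]) (hφ.inner_coe_dphi p w),
      inner_smul_left, ← hφ.tanProj_dphi p w, ← inner_tanProj, hφ.tanProj_meanCurv,
      inner_zero_left, mul_zero, zero_smul, zero_sub, hφ.tanProj_dphi, hφ.inner_dphi]
  simp only [h]
  rw [trace, Finset.sum_neg_distrib, ← Finset.sum_smul]
  congr 2
  exact trace_inner_self p

theorem sphereProj_shapeOp (hφ : IsIsometricImmersion m φ) (hH : HasParallelMeanCurv m φ)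
    (p : M) (u : Euc n) :
    sphereProj (φ p : Euc n) (shapeOp m φ p u) = shapeOp m φ p u := by
  refine sphereProj_eq_self ?_
  rw [← hφ.tanProj_shapeOp hH, hφ.inner_coe_tanProj]

theorem pullbackConn_tension (hφ : IsIsometricImmersion m φ) (hH : HasParallelMeanCurv m φ)
    (hm : (m : ℝ) ≠ 0) (v : TangentSpace (𝓡 m) p) :
    pullbackConn m φ (tension m φ) p v = (-m : ℝ) • shapeOp m φ p (dphi m φ p v) := by
  have h := mvfderiv_clm_comp ((m : ℝ) • ContinuousLinearMap.id ℝ (Euc n))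
    (hφ.mdifferentiableAt_meanCurv p) v
  rw [hφ.mvfderiv_meanCurv] at h
  rw [hφ.tension_eq_smul_meanCurv hm, pullbackConn]
  have h' : dirDeriv m (fun q => (m : ℝ) • meanCurv m φ q) p v =
      (m : ℝ) • -shapeOp m φ p (dphi m φ p v) := h
  rw [h', smul_neg, ← neg_smul]
  conv_rhs => rw [← hφ.sphereProj_shapeOp hH]
  rw [sphereProj, sphereProj, inner_smul_right]
  module

/-- Since `∇^φ_w τ = -m S w`, the Leibniz rule for `S W` produces `S(∇_v W)`, which cancels the
correction term of `∇²`. -/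
theorem laplacian_tension (hφ : IsIsometricImmersion m φ) (hH : HasParallelMeanCurv m φ)
    (hm : (m : ℝ) ≠ 0) (p : M) :
    laplacian m φ (tension m φ) p = (m : ℝ) • trace m p fun v w => sphereProj (φ p : Euc n)
      (tder m φ (shapeOp m φ) p (dphi m φ p v) (dphi m φ p w)) := by
  have h : ∀ v w : TangentSpace (𝓡 m) p,
      pullbackConn m φ (fun q => pullbackConn m φ (tension m φ) q (extendVec m w q)) p v
        - pullbackConn m φ (tension m φ) p (leviCivita m φ (extendVec m w) p v) =
      -((m : ℝ) • sphereProj (φ p : Euc n)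
        (tder m φ (shapeOp m φ) p (dphi m φ p v) (dphi m φ p w))) := by
    intro v w
    have hW := hφ.mdifferentiableAt_dphi_extendVec w
    have h := mvfderiv_clm_comp ((-m : ℝ) • ContinuousLinearMap.id ℝ (Euc n))
      ((hφ.mdifferentiableAt_shapeOp p).clm_apply hW) v
    rw [hφ.mvfderiv_shapeOp_dphi hW, extendVec_self] at h
    simp only [hφ.pullbackConn_tension hH hm]
    have h' : dirDeriv m (fun q => (-m : ℝ) • shapeOp m φ q (dphi m φ q (extendVec m w q))) p v =
      (-m : ℝ) • (shapeOp m φ p (dphi m φ p (leviCivita m φ (extendVec m w) p v)) +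
        tder m φ (shapeOp m φ) p (dphi m φ p v) (dphi m φ p w)) := h
    rw [pullbackConn, h']
    conv_lhs => rw [← hφ.sphereProj_shapeOp hH p (dphi m φ p (leviCivita m φ _ p v))]
    rw [hφ.sphereProj_shapeOp hH]
    have hs := hφ.sphereProj_shapeOp hH p (dphi m φ p (leviCivita m φ (extendVec m w) p v))
    rw [sphereProj, sub_eq_self] at hs
    simp only [sphereProj, inner_smul_right, inner_add_right, mul_add, add_smul, mul_smul, hs]
    module
  rw [laplacian]
  simp only [h]
  rw [trace, Finset.sum_neg_distrib, neg_neg, trace, Finset.smul_sum]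

theorem trace_tder_shapeOp_of_isBiharmonic (hφ : IsIsometricImmersion m φ)
    (hH : HasParallelMeanCurv m φ)
    (hbi : IsProperBiharmonic m φ) (p : M) :
    (trace m p fun v w => sphereProj (φ p : Euc n)
      (tder m φ (shapeOp m φ) p (dphi m φ p v) (dphi m φ p w))) = (m : ℝ) • meanCurv m φ p := by
  have hm := hbi.dim_ne_zero
  have h := hbi.1 p
  rw [bitension, hφ.laplacian_tension hH hm, hφ.trace_sphereCurvature_tension hm, sub_neg_eq_add,
    neg_add_eq_zero] at h
  exact smul_right_injective _ hm h

theorem trace_nablaAH (hφ : IsIsometricImmersion m φ) (hH : HasParallelMeanCurv m φ)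
    (hbi : IsProperBiharmonic m φ) (p : M) :
    trace m p (nablaAH m φ p) = 0 := by
  refine hφ.dphi_injective p ?_
  have h := congrArg (tanProj m φ p) (hφ.trace_tder_shapeOp_of_isBiharmonic hH hbi p)
  rw [trace, map_sum, map_smul, hφ.tanProj_meanCurv, smul_zero] at h
  rw [trace, map_sum, map_zero, ← h]
  refine Finset.sum_congr rfl fun i _ => ?_
  rw [hφ.dphi_nablaAH hH, hφ.tanProj_sphereProj]

theorem normSqAH_eq_trace (hφ : IsIsometricImmersion m φ) (hH : HasParallelMeanCurv m φ)
    (p : M) : normSqAH m φ p = trace m p fun v w =>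
    (inner ℝ (shapeOp m φ p (dphi m φ p v)) (shapeOp m φ p (dphi m φ p w)) : ℝ) := by
  simp only [normSqAH, ← hφ.dphi_AH hH, hφ.inner_dphi]

/-- The product of the biharmonic equation with `H`: `⟨(D_v S) v, H⟩ = ⟨v, (D_v S) H⟩ = ⟨v, S² v⟩ =
|S v|²`. -/
theorem normSqAH_eq (hφ : IsIsometricImmersion m φ) (hH : HasParallelMeanCurv m φ)
    (hbi : IsProperBiharmonic m φ) (p : M) :
    normSqAH m φ p = m * ‖meanCurv m φ p‖ ^ 2 := by
  have h := congrArg (fun z => (inner ℝ z (meanCurv m φ p) : ℝ))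
    (hφ.trace_tder_shapeOp_of_isBiharmonic hH hbi p)
  simp only [inner_smul_left, real_inner_self_eq_norm_sq] at h
  rw [trace, sum_inner] at h
  refine Eq.trans ?_ h
  rw [hφ.normSqAH_eq_trace hH, trace]
  refine Finset.sum_congr rfl fun i _ => ?_
  rw [sphereProj, inner_sub_left, inner_smul_left, hφ.inner_coe_meanCurv, mul_zero, sub_zero,
    hφ.inner_tder_shapeOp hH, hφ.tder_shapeOp_meanCurv, hφ.inner_shapeOp hH]

theorem norm_sq_meanCurv_eq (hφ : IsIsometricImmersion m φ) (hH : HasParallelMeanCurv m φ)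
    [ConnectedSpace M] (p q : M) :
    ‖meanCurv m φ p‖ ^ 2 = ‖meanCurv m φ q‖ ^ 2 := by
  have hd := hφ.mdifferentiableAt_meanCurv
  rw [← real_inner_self_eq_norm_sq, ← real_inner_self_eq_norm_sq]
  refine eq_of_mvfderiv_eq_zero (σ := fun q => (inner ℝ (meanCurv m φ q) (meanCurv m φ q) : ℝ))
    (fun r => MDifferentiableAt.bilinear (innerSL ℝ) (hd r) (hd r)) (fun r => ?_) p q
  ext v
  rw [mvfderiv_inner (hd r) (hd r), hφ.mvfderiv_meanCurv, ← hφ.tanProj_shapeOp hH, inner_neg_left,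
    inner_neg_right, inner_tanProj, ← inner_tanProj, hφ.tanProj_meanCurv, inner_zero_left,
    inner_zero_right]
  simp

theorem exists_normSqAH_eq (hφ : IsIsometricImmersion m φ) (hH : HasParallelMeanCurv m φ)
    [ConnectedSpace M] (hbi : IsProperBiharmonic m φ) :
    ∃ c : ℝ, ∀ p, normSqAH m φ p = c := by
  obtain ⟨p₀⟩ := (inferInstance : Nonempty M)
  refine ⟨m * ‖meanCurv m φ p₀‖ ^ 2, fun p => ?_⟩
  rw [hφ.normSqAH_eq hH hbi, hφ.norm_sq_meanCurv_eq hH p p₀]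

/-- Over a basis independent of `p`, the sum can be differentiated term by term. -/
theorem normSqAH_eq_sum (hφ : IsIsometricImmersion m φ) (hH : HasParallelMeanCurv m φ)
    {ι : Type*} [Fintype ι] (b : OrthonormalBasis ι ℝ (Euc n)) (p : M) :
    normSqAH m φ p = ∑ k, (inner ℝ (shapeOp m φ p (b k)) (shapeOp m φ p (b k)) : ℝ) := by
  have h := hφ.trace_dphi b ((innerSL ℝ).bilinearComp (shapeOp m φ p) (shapeOp m φ p)) p
  rw [hφ.normSqAH_eq_trace hH]
  refine h.trans (Finset.sum_congr rfl fun k _ => ?_)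
  change inner ℝ (shapeOp m φ p _) (shapeOp m φ p _) = _
  rw [hφ.shapeOp_tanProj]

/-- The trace of the derivative of `A_H` against `A_H` is half the derivative of `|A_H|²`. -/
theorem trace_inner_tder_shapeOp (hφ : IsIsometricImmersion m φ) (hH : HasParallelMeanCurv m φ)
    {c : ℝ} (hc : ∀ p, normSqAH m φ p = c) (p : M) (x : Euc n) :
    (trace m p fun v w => (inner ℝ (tder m φ (shapeOp m φ) p x (dphi m φ p v))
      (shapeOp m φ p (dphi m φ p w)) : ℝ)) = 0 := by
  set b := EuclideanSpace.basisFun (Fin (n + 1)) ℝ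
  set D := tder m φ (shapeOp m φ) p x
  have hs := hφ.mdifferentiableAt_shapeOp p
  have hk : ∀ k, MDifferentiableAt (𝓡 m) 𝓘(ℝ, Euc n) (fun q => shapeOp m φ q (b k)) p :=
    fun k => hs.clm_apply mdifferentiableAt_const
  have htr : (trace m p fun v w => (inner ℝ (D (dphi m φ p v))
      (shapeOp m φ p (dphi m φ p w)) : ℝ)) = ∑ k, (inner ℝ (D (b k)) (shapeOp m φ p (b k)) : ℝ) := by
    have h := hφ.trace_dphi b ((innerSL ℝ).bilinearComp D (shapeOp m φ p)) p
    refine h.trans ?_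
    -- By the symmetry of `S`, the sum over the projected basis is `tr(S D P)`. Cyclicity gives
    -- `tr(P S D)`, and `P S = S` removes the projection.
    have h₁ := ((shapeOp m φ p ∘L D).toLinearMap ∘ₗ (tanProj m φ p).toLinearMap).trace_eq_sum_inner b
    have h₂ := ((tanProj m φ p).toLinearMap ∘ₗ (shapeOp m φ p ∘L D).toLinearMap).trace_eq_sum_inner b
    rw [LinearMap.trace_comp_comm'] at h₁
    refine Eq.trans (Eq.trans ?_ (h₁.symm.trans h₂)) ?_
    · refine Finset.sum_congr rfl fun k _ => ?_
      change inner ℝ (D _) (shapeOp m φ p _) = inner ℝ _ (shapeOp m φ p (D _))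
      rw [hφ.shapeOp_tanProj, real_inner_comm, hφ.inner_shapeOp hH]
      rfl
    · refine Finset.sum_congr rfl fun k _ => ?_
      change inner ℝ _ (tanProj m φ p (shapeOp m φ p (D _))) = _
      rw [hφ.tanProj_shapeOp hH, ← hφ.inner_shapeOp hH, real_inner_comm]
  have hsum : mvfderiv (𝓡 m) (fun q => ∑ k, (inner ℝ (shapeOp m φ q (b k))
      (shapeOp m φ q (b k)) : ℝ)) p (tangentPart m φ p x) =
      ∑ k, 2 * (inner ℝ (D (b k)) (shapeOp m φ p (b k)) : ℝ) := by
    refine (mvfderiv_sum Finset.univ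
      (fun k => MDifferentiableAt.bilinear (innerSL ℝ) (hk k) (hk k)) _).2.trans ?_
    refine Finset.sum_congr rfl fun k _ => ?_
    refine (mvfderiv_inner (hk k) (hk k) _).trans ?_
    rw [mvfderiv_clm_apply_const hs,
      real_inner_comm, ← two_mul]
    rfl
  simp only [← hφ.normSqAH_eq_sum hH b, hc, mvfderiv_const] at hsum
  rw [← Finset.mul_sum, ← htr] at hsum
  have : (0 : ℝ) = 2 * _ := hsum
  linarith

theorem inner_trace_nablaB_left (hφ : IsIsometricImmersion m φ) (hH : HasParallelMeanCurv m φ)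
    {c : ℝ} (hc : ∀ p, normSqAH m φ p = c) (p : M)
    (X : TangentSpace (𝓡 m) p) :
    inner ℝ (trace m p fun v w => nablaB m φ p X v (AH m φ p w)) (meanCurv m φ p) = (0 : ℝ) := by
  rw [← hφ.trace_inner_tder_shapeOp hH hc p (dphi m φ p X), trace, trace, sum_inner]
  refine Finset.sum_congr rfl fun i _ => ?_
  rw [hφ.inner_nablaB_meanCurv hH, hφ.dphi_AH hH]

theorem inner_trace_nablaB_right (hφ : IsIsometricImmersion m φ) (hH : HasParallelMeanCurv m φ)
    {c : ℝ} (hc : ∀ p, normSqAH m φ p = c) (p : M)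
    (X : TangentSpace (𝓡 m) p) :
    inner ℝ (trace m p fun v w => nablaB m φ p v X (AH m φ p w)) (meanCurv m φ p) = (0 : ℝ) := by
  rw [← hφ.trace_inner_tder_shapeOp hH hc p (dphi m φ p X), trace, trace, sum_inner]
  refine Finset.sum_congr rfl fun i _ => ?_
  have h := hφ.tder_shapeOp_symm p (dphi m φ p (frame m p i)) (dphi m φ p X)
  simp only [hφ.tanProj_dphi] at h
  rw [hφ.inner_nablaB_meanCurv hH, hφ.dphi_AH hH, h]

end IsIsometricImmersion

end Biharmonic

end BiharmonicSphere

end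

open BiharmonicSphere in
theorem mainTheorem4 {m n : ℕ} {M : Type*} [TopologicalSpace M]
    [ChartedSpace (EuclideanSpace ℝ (Fin m)) M] [IsManifold (𝓡 m) ∞ M] [ConnectedSpace M]
    [Bundle.RiemannianBundle (fun p : M => TangentSpace (𝓡 m) p)]
    (φ : M → Metric.sphere (0 : EuclideanSpace ℝ (Fin (n + 1))) 1)
    (hφ : IsIsometricImmersion m φ) (hbi : IsProperBiharmonic m φ) (hH : HasParallelMeanCurv m φ) :
    ((∀ p, normSqAH m φ p = m * ‖meanCurv m φ p‖ ^ 2) ∧ ∃ c : ℝ, ∀ p, normSqAH m φ p = c) ∧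
    (∀ p, trace m p (nablaAH m φ p) = 0) ∧
    (∀ (p : M) (X : TangentSpace (𝓡 m) p),
      inner ℝ (trace m p fun v w => nablaB m φ p X v (AH m φ p w)) (meanCurv m φ p) = 0 ∧
      inner ℝ (trace m p fun v w => nablaB m φ p v X (AH m φ p w)) (meanCurv m φ p) = 0) := by
  obtain ⟨c, hc⟩ := hφ.exists_normSqAH_eq hH hbi
  exact ⟨⟨hφ.normSqAH_eq hH hbi, c, hc⟩, hφ.trace_nablaAH hH hbi, fun p X =>
    ⟨hφ.inner_trace_nablaB_left hH hc p X, hφ.inner_trace_nablaB_right hH hc p X⟩⟩
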